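/- Let $K$ be an algebraically closed field, let $n\ge 1$ and $m$ be integers with $m\ge 0$, and let $\operatorname{GL}_n(K)$ act on the space $V=\operatorname{Mat}_{n,n}(K)^m$ of $m$-tuples of $n\times n$ matrices by simultaneous conjugation, $g\cdot(X_1,\dots,X_m)=(gX_1g^{-1},\dots,gX_mg^{-1})$. Let $S(n,m)=K[V]^{\operatorname{GL}_n}$ be the ring of polynomial functions on $V$ that are constant on orbits, and let $S(n,m)_d$ be its homogeneous part of degree $d$. A set $\mathcal S\subseteq S(n,m)$ is called separating if for all $A,B\in V$ whose orbits have disjoint Zariski closures there is $f\in\mathcal S$ with $f(A)\ne f(B)$. Let $\beta_{\mathrm{sep}}(S(n,m))$ be the smallest integer $D\ge 1$ such that $\bigcup_{d=1}^{D}S(n,m)_d$ is a separating set. Then such a $D$ exists, and $$\beta_{\mathrm{sep}}(S(n,m))\le 4n^2\log_2 n+12n^2-4n .$$ If moreover $K$ has characteristic $0$, then $$\beta_{\mathrm{sep}}(S(n,m))\le 4n\log_2 n+12n-4 .$$ -/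

import Mathlib

namespace MatInv

/-- The space `Mat_{n,n}^m` of `m`-tuples of `n × n` matrices over `K`. -/
abbrev MatTuple (K : Type*) (n m : ℕ) := Fin m → Matrix (Fin n) (Fin n) K

/-- Polynomials on `Mat_{n,n}^m`: the variable `(i, a, b)` is the `(a, b)` entry of the `i`-th
matrix. -/
abbrev Poly (K : Type*) [Field K] (n m : ℕ) := MvPolynomial (Fin m × Fin n × Fin n) K

section

variable {K : Type*} [Field K] {n m : ℕ}

/-- The value of a polynomial at a tuple of matrices. -/
noncomputable def evalAt (f : Poly K n m) (X : MatTuple K n m) : K :=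
  MvPolynomial.eval (fun p => X p.1 p.2.1 p.2.2) f

/-- Simultaneous conjugation `g · (X₁, …, X_m) = (g X₁ g⁻¹, …, g X_m g⁻¹)`. -/
def conj (g : GL (Fin n) K) (X : MatTuple K n m) : MatTuple K n m :=
  fun i => (g : Matrix (Fin n) (Fin n) K) * X i * ((g⁻¹ : GL (Fin n) K) : Matrix (Fin n) (Fin n) K)

/-- The orbit of a tuple under simultaneous conjugation. -/
def orbit (X : MatTuple K n m) : Set (MatTuple K n m) :=
  Set.range fun g : GL (Fin n) K => conj g X

/-- The closure of a set in the Zariski topology: the common zeros of all polynomials that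
vanish on the set. -/
def zariskiClosure (S : Set (MatTuple K n m)) : Set (MatTuple K n m) :=
  {X | ∀ f : Poly K n m, (∀ Y ∈ S, evalAt f Y = 0) → evalAt f X = 0}

/-- Closure equivalence: the orbit closures intersect. -/
def ClosureEquiv (X Y : MatTuple K n m) : Prop :=
  (zariskiClosure (orbit X) ∩ zariskiClosure (orbit Y)).Nonempty

end

/-- The ring `S(n, m)` of matrix invariants. -/
noncomputable def invariantRing (K : Type*) [Field K] (n m : ℕ) : Subalgebra K (Poly K n m) where
  carrier := {f | ∀ (g : GL (Fin n) K) (X : MatTuple K n m), evalAt f (conj g X) = evalAt f X}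
  mul_mem' := by
    intro a b ha hb g X
    have h1 := ha g X
    have h2 := hb g X
    simp only [evalAt, map_mul] at h1 h2 ⊢
    rw [h1, h2]
  add_mem' := by
    intro a b ha hb g X
    have h1 := ha g X
    have h2 := hb g X
    simp only [evalAt, map_add] at h1 h2 ⊢
    rw [h1, h2]
  algebraMap_mem' := by
    intro r g X
    simp [evalAt, MvPolynomial.algebraMap_eq]

/-- The homogeneous invariants of degree `d`. -/
def invariantsOfDegree (K : Type*) [Field K] (n m d : ℕ) : Set (Poly K n m) :=
  {f | f ∈ invariantRing K n m ∧ f.IsHomogeneous d}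

/-- A set of invariants is separating if it separates any two tuples that are not closure
equivalent. -/
def IsSeparatingSet {K : Type*} [Field K] {n m : ℕ} (S : Set (Poly K n m)) : Prop :=
  S ⊆ (invariantRing K n m : Set (Poly K n m)) ∧
    ∀ X Y : MatTuple K n m, ¬ ClosureEquiv X Y → ∃ f ∈ S, evalAt f X ≠ evalAt f Y

/-- The positive integers `D` such that the homogeneous invariants of degrees `1, …, D` form a
separating set. -/
def separatingDegrees (K : Type*) [Field K] (n m : ℕ) : Set ℕ :=
  {D | 1 ≤ D ∧ IsSeparatingSet (⋃ d ∈ Set.Icc 1 D, invariantsOfDegree K n m d)}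

/-- `β_sep(S(n, m))`, the least element of `separatingDegrees K n m`. (The infimum is an attained
minimum exactly when that set is nonempty.) -/
noncomputable def betaSep (K : Type*) [Field K] (n m : ℕ) : ℕ :=
  sInf (separatingDegrees K n m)

end MatInv

/-!
Write "word of length `d`" for an element of `S ^ d`, where `S` is the span of the identity and the
given matrices.

**Reduction to semisimple tuples.** If the algebra generated by a tuple `X` contains `j ≠ 0` with
`j A j = 0`, then the block-diagonal part of `X` for the stable subspace `A j Kⁿ` lies in the orbit
closure of `X` and generates an algebra of smaller dimension
(`exists_mem_zariskiClosure_finrank_lt`). So every orbit closure contains a tuple generating a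
semiprime algebra. Given two such tuples `X` and `Y`, the algebra `A` generated by the pairs
`(X i, Y i)` is Artinian and semiprime, hence semisimple, and `X` and `Y` are conjugate as soon as
the two `A`-modules `Kⁿ` they define are isomorphic.

**Short words detect isomorphism.** Traces and coefficients of characteristic polynomials of words
in generic matrices are invariants of bounded degree, so it remains to show that two modules `M`,
`M'` over a semisimple algebra, with `N = dim M + dim M'`, are isomorphic when all words of some
length at least `2 N log₂ N + N` have the same characteristic polynomial (or trace, in characteristic
zero) on both (`nonempty_linearEquiv_of_charpoly_eq_or_trace_eq`). There is a word `e` of this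
length acting on `M × M'` as a nonzero idempotent with `e A e = K e`. By assumption `e` is nonzero
on both factors; vectors `x ∈ e M` and `y ∈ e M'` have the same annihilator, so `A x` and `A y` are
isomorphic summands, which can be split off, and induction on the dimension applies.

**Rank reduction.** The idempotent comes from a nonzero word `P` of length at most `2 N log₂ N`
such that `P w P ∈ K P` for all words `w` (`exists_mul_mul_mem_span`). The ranks of such words are
lowered step by step, with length at most `2 x log₂ x` for a word of rank `r`, where `x = N / r`.
Let `P w P ∉ K P` with `w` of minimal length `j`. If `j` is at most `3 N / r`, a product of `d - 1`
factors `P w - μ`, applied to `P`, has rank at most `r / d`, where `d ≥ 2` is the degree of the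
minimal polynomial of `P w` on the range of `P`. If `j` is larger, `w` may be taken to end in a
factor `ρ` of length at most `N / r` for which `P w ρ P` vanishes for many `w`
(`exists_annihilated_factor`); the first nonvanishing `P w ρ P` then has rank `m` with
`m · (j - N / r) ≤ N` (`exists_first_return`), and `2 m ≤ r`.
-/

namespace MatInv

open Module

/-! ### Words returning to a small image -/

section RankReduction

variable {K L : Type*} [Field K] [AddCommGroup L] [Module K L]

theorem pow_mono_of_one_mem {A : Type*} [Ring A] [Algebra K A] {S : Submodule K A}
    (h1 : (1 : A) ∈ S) {i j : ℕ} (hij : i ≤ j) : S ^ i ≤ S ^ j := by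
  have h : (1 : Submodule K A) ≤ S := Submodule.one_le.mpr h1
  exact pow_le_pow_right' h hij

theorem one_mem_pow_zero {A : Type*} [Ring A] [Algebra K A] (S : Submodule K A) :
    (1 : A) ∈ S ^ 0 := by
  rw [pow_zero]; exact Submodule.one_le.mp le_rfl

theorem finrank_map_add_finrank_le [FiniteDimensional K L] (f : End K L) {W W' : Submodule K L}
    (hle : W ≤ W') (hker : ∀ x ∈ W, f x = 0) :
    finrank K (W'.map f) + finrank K W ≤ finrank K W' := by
  have h := LinearMap.finrank_range_add_finrank_ker (f.domRestrict W')
  rw [LinearMap.range_domRestrict] at h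
  have h2 : finrank K W ≤ finrank K (LinearMap.ker (f.domRestrict W')) := by
    have hW : finrank K (W.comap W'.subtype) = finrank K W :=
      (Submodule.comapSubtypeEquivOfLe hle).finrank_eq
    rw [← hW]
    apply Submodule.finrank_mono
    intro x hx
    simp only [Submodule.mem_comap, Submodule.subtype_apply] at hx
    simpa using hker _ hx
  omega

/-- Let `b` be the least length of a word `w` with `v w W ≠ 0`. Some such `w` of length `b` has
`b · dim (v w W) + dim W ≤ dim L`: in the chain `W ≤ S W ≤ S² W ≤ ⋯` each of the first `b` steps
raises the dimension by at least `dim (v w W)`, since `v` times a left factor of `w` maps the larger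
space onto a space containing `v w W` and kills the smaller one. -/
theorem exists_first_return [FiniteDimensional K L] (S : Submodule K (End K L)) (h1 : 1 ∈ S)
    (v : End K L) (b : ℕ) :
    ∀ W : Submodule K L, (∀ a < b, ∀ w ∈ S ^ a, ∀ x ∈ W, v (w x) = 0) →
      (∃ w ∈ S ^ b, ∃ x ∈ W, v (w x) ≠ 0) →
      ∃ w ∈ S ^ b, (∃ x ∈ W, v (w x) ≠ 0) ∧
        b * finrank K (W.map (v * w)) + finrank K W ≤ finrank K L := by
  induction b with
  | zero =>
    rintro W - ⟨w, hw, x, hx, hne⟩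
    exact ⟨w, hw, ⟨x, hx, hne⟩, by simpa using Submodule.finrank_le W⟩
  | succ b ih =>
    intro W hz hne
    set W1 : Submodule K L := Submodule.span K {y | ∃ s ∈ S, ∃ x ∈ W, y = s x} with hW1
    have hWW1 : W ≤ W1 := fun x hx => Submodule.subset_span ⟨1, h1, x, hx, rfl⟩
    have hz1 : ∀ a < b, ∀ w ∈ S ^ a, ∀ x ∈ W1, v (w x) = 0 := by
      intro a ha w hw x hx
      have : W1 ≤ LinearMap.ker (v * w) := by
        rw [hW1, Submodule.span_le]
        rintro y ⟨s, hs, x, hx, rfl⟩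
        have := hz (a + 1) (by omega) (w * s)
          (by rw [pow_succ]; exact Submodule.mul_mem_mul hw hs) x hx
        simpa using this
      simpa using this hx
    have hne1 : ∃ w ∈ S ^ b, ∃ x ∈ W1, v (w x) ≠ 0 := by
      by_contra! hcon
      obtain ⟨w, hw, x, hx, hx0⟩ := hne
      rw [pow_succ] at hw
      apply hx0
      induction hw using Submodule.mul_induction_on' with
      | mem_mul_mem p hp s hs =>
        exact hcon p hp (s x) (Submodule.subset_span ⟨s, hs, x, hx, rfl⟩)
      | add p _ q _ hp hq =>
        by_contra hcc
        apply hcc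
        have hp' : v (p x) = 0 := by
          by_contra h; exact h (hp h)
        have hq' : v (q x) = 0 := by
          by_contra h; exact h (hq h)
        simp [hp', hq']
    obtain ⟨w, hw, ⟨y, hy, hwy⟩, hdim⟩ := ih W1 hz1 hne1
    have : ∃ s ∈ S, ∃ x ∈ W, v (w (s x)) ≠ 0 := by
      by_contra! hcon
      apply hwy
      have : W1 ≤ LinearMap.ker (v * w) := by
        rw [hW1, Submodule.span_le]
        rintro y ⟨s, hs, x, hx, rfl⟩
        simpa using hcon s hs x hx
      simpa using this hy
    obtain ⟨s, hs, x, hx, hne'⟩ := this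
    refine ⟨w * s, by rw [pow_succ]; exact Submodule.mul_mem_mul hw hs, ⟨x, hx, hne'⟩, ?_⟩
    have hk : finrank K (W1.map (v * w)) + finrank K W ≤ finrank K W1 :=
      finrank_map_add_finrank_le (v * w) hWW1
        (fun x hx => by simpa using hz b (by omega) w hw x hx)
    have hm : finrank K (W.map (v * (w * s))) ≤ finrank K (W1.map (v * w)) := by
      apply Submodule.finrank_mono
      rintro _ ⟨x, hx, rfl⟩
      exact ⟨s x, Submodule.subset_span ⟨s, hs, x, hx, rfl⟩, rfl⟩
    nlinarith

/-- If every `P w (t k) P` with `w ∈ V` is a multiple of `P`, and no nontrivial combination `t` of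
the `t k` satisfies `P w t P = 0` for all `w ∈ V`, then the maps `t k` embed `q` independent copies
of the range of `P` into `L`. -/
theorem card_mul_finrank_range_le [FiniteDimensional K L] {P : End K L}
    {V : Submodule K (End K L)} {q : ℕ} (t : Fin q → End K L)
    (hsc : ∀ w ∈ V, ∀ k, P * w * t k * P ∈ Submodule.span K {P})
    (hind : ∀ c : Fin q → K, (∀ w ∈ V, P * w * (∑ k, c k • t k) * P = 0) → c = 0) :
    q * finrank K (LinearMap.range P) ≤ finrank K L := by
  let Φ : (Fin q → LinearMap.range P) →ₗ[K] L :=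
    ∑ k, (t k) ∘ₗ (LinearMap.range P).subtype ∘ₗ LinearMap.proj k
  have hΦ : ∀ z, Φ z = ∑ k, t k (z k : L) := by
    intro z; simp [Φ, LinearMap.sum_apply]
  have hinj : Function.Injective Φ := by
    rw [injective_iff_map_eq_zero]
    intro z hz
    rw [hΦ] at hz
    have key : ∀ φ : Dual K L, (fun k => φ (z k : L)) = 0 := by
      intro φ
      apply hind
      intro w hw
      have hγ : ∀ k, ∃ γ : K, γ • P = P * w * t k * P := fun k =>
        Submodule.mem_span_singleton.mp (hsc w hw k)
      choose γ hγ using hγ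
      have hs : ∑ k, γ k • (z k : L) = 0 := by
        have : P (w (∑ k, t k (z k : L))) = 0 := by rw [hz]; simp
        rw [map_sum, map_sum] at this
        rw [← this]
        refine Finset.sum_congr rfl fun k _ => ?_
        obtain ⟨y, hy⟩ := (z k).2
        have := congrArg (fun f : End K L => f y) (hγ k)
        simp only [LinearMap.smul_apply, Module.End.mul_apply] at this
        rw [← hy, this]
      have hs' : ∑ k, γ k * φ (z k : L) = 0 := by
        have := congrArg φ hs
        simpa [map_sum] using this
      rw [Finset.mul_sum, Finset.sum_mul]
      have : ∀ k, P * w * (φ (z k : L) • t k) * P = (γ k * φ (z k : L)) • P := by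
        intro k
        rw [mul_smul_comm, smul_mul_assoc, ← hγ k, smul_smul, mul_comm]
      simp_rw [this]
      rw [← Finset.sum_smul, hs', zero_smul]
    funext k
    apply Subtype.ext
    apply (Module.forall_dual_apply_eq_zero_iff K (z k : L)).mp
    intro φ
    exact congrFun (key φ) k
  have := LinearMap.finrank_le_finrank_of_injective hinj
  simpa [Module.finrank_pi_fintype] using this

/-- Let `j` be the least length of a word with `P w P` not a multiple of `P`, and suppose
`j > h ≥ ⌊N / rank P⌋`. A word of length `j` with this property can be taken of the form `τ ρ`
with `ρ` of length at most `h` and `P w ρ P = 0` for all words `w` of length at most `j - 1 - h`.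
Modulo the `t` with `P w t P = 0` for all these `w`, the words of length at most `h` span a space
of dimension at most `h`, by `card_mul_finrank_range_le`, so its filtration by length has a
repetition, and `ρ` is the difference of two words that agree in the quotient. -/
theorem exists_annihilated_factor [FiniteDimensional K L] {S : Submodule K (End K L)} (h1 : 1 ∈ S)
    {P : End K L} {j h : ℕ} (hj : h + 1 ≤ j)
    (hh : finrank K L < (h + 1) * finrank K (LinearMap.range P))
    (hsc : ∀ i < j, ∀ w ∈ S ^ i, P * w * P ∈ Submodule.span K {P})
    {w₀ : End K L} (hw₀ : w₀ ∈ S ^ j) (hw₀' : P * w₀ * P ∉ Submodule.span K {P}) :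
    ∃ i ≤ h, ∃ ρ ∈ S ^ i, ∃ τ ∈ S ^ (j - i), P * (τ * ρ) * P ∉ Submodule.span K {P} ∧
      ∀ w ∈ S ^ (j - 1 - h), P * (w * ρ) * P = 0 := by
  let Ann : Submodule K (End K L) :=
    { carrier := {t | ∀ w ∈ S ^ (j - 1 - h), P * (w * t) * P = 0}
      zero_mem' := by intro w _; simp
      add_mem' := by
        intro a b ha hb w hw
        rw [mul_add, mul_add, add_mul, ha w hw, hb w hw, add_zero]
      smul_mem' := by
        intro c a ha w hw
        rw [mul_smul_comm, mul_smul_comm, smul_mul_assoc, ha w hw, smul_zero] }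
  have hmem : ∀ t, t ∈ Ann ↔ ∀ w ∈ S ^ (j - 1 - h), P * (w * t) * P = 0 := fun t => Iff.rfl
  let F : ℕ → Submodule K (End K L ⧸ Ann) := fun i => (S ^ i).map Ann.mkQ
  have hFmono : ∀ i k, i ≤ k → F i ≤ F k := fun i k hik =>
    Submodule.map_mono (pow_mono_of_one_mem h1 hik)
  have hFh : finrank K (F h) ≤ h := by
    by_contra! hlt
    let B := Module.finBasis K (F h)
    have hlift : ∀ k, ∃ t ∈ S ^ h, Ann.mkQ t = (B k : End K L ⧸ Ann) := fun k => (B k).2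
    choose t ht htB using hlift
    have := card_mul_finrank_range_le (P := P) (V := S ^ (j - 1 - h)) t
      (fun w hw k => by
        have : w * t k ∈ S ^ (j - 1 - h + h) := by
          rw [pow_add]; exact Submodule.mul_mem_mul hw (ht k)
        have h2 := hsc (j - 1 - h + h) (by omega) _ this
        rwa [← mul_assoc] at h2)
      (fun c hc => by
        have hA : (∑ k, c k • t k) ∈ Ann := by
          intro w hw
          have := hc w hw
          rwa [mul_assoc P w] at this
        have h0 : ∑ k, c k • (B k) = 0 := by
          apply Subtype.ext
          have hA' : Ann.mkQ (∑ k, c k • t k) = 0 := (Submodule.Quotient.mk_eq_zero _).mpr hA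
          rw [map_sum] at hA'
          simpa [htB] using hA'
        funext k
        exact (Fintype.linearIndependent_iff.mp B.linearIndependent c h0) k)
    have h3 : (h + 1) * finrank K (LinearMap.range P) ≤
        finrank K (F h) * finrank K (LinearMap.range P) := Nat.mul_le_mul_right _ hlt
    omega
  -- the chain of images cannot increase strictly `h` times
  have hstab : (1 : End K L) ∈ Ann ∨ ∃ i, i + 1 ≤ h ∧ F (i + 1) ≤ F i := by
    by_contra! hcon
    obtain ⟨h0, hs⟩ := hcon
    have : ∀ i ≤ h, i + 1 ≤ finrank K (F i) := by
      intro i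
      induction i with
      | zero =>
        intro _
        rw [Nat.succ_le_iff, Module.finrank_pos_iff_exists_ne_zero]
        refine ⟨⟨Ann.mkQ 1, ⟨1, one_mem_pow_zero S, rfl⟩⟩, fun h => h0 ?_⟩
        have := congrArg Subtype.val h
        simpa using this
      | succ i ih =>
        intro hi
        have := ih (by omega)
        have hlt : F i < F (i + 1) := lt_of_le_not_ge (hFmono _ _ (by omega)) (hs i hi)
        have := Submodule.finrank_lt_finrank_of_lt hlt
        omega
    have := this h le_rfl
    omega
  rcases hstab with h0 | ⟨i, hi, hle⟩
  · exact ⟨0, Nat.zero_le _, 1, one_mem_pow_zero S, w₀, by simpa using hw₀, by simpa using hw₀',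
      fun w hw => by simpa using h0 w hw⟩
  · have hprod : ∃ τ ∈ S ^ (j - (i + 1)), ∃ t ∈ S ^ (i + 1),
        P * (τ * t) * P ∉ Submodule.span K {P} := by
      by_contra! hcon
      have hsplit : w₀ ∈ S ^ (j - (i + 1)) * S ^ (i + 1) := by
        rw [← pow_add]; convert hw₀ using 2; omega
      have hle : S ^ (j - (i + 1)) * S ^ (i + 1) ≤ (Submodule.span K {P}).comap
          ((LinearMap.mulRight K P).comp (LinearMap.mulLeft K P)) :=
        Submodule.mul_le.mpr fun τ hτ t ht => hcon τ hτ t ht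
      exact hw₀' (hle hsplit)
    obtain ⟨τ, hτ, t, ht, hne⟩ := hprod
    have htF : Ann.mkQ t ∈ F i := hle ⟨t, ht, rfl⟩
    obtain ⟨t', ht', htt'⟩ := htF
    refine ⟨i + 1, hi, t - t', sub_mem ht (pow_mono_of_one_mem h1 (Nat.le_succ i) ht'), τ, hτ,
      ?_, ?_⟩
    · intro hcon
      apply hne
      have h2 : P * (τ * t') * P ∈ Submodule.span K {P} := by
        apply hsc (j - (i + 1) + i) (by omega)
        rw [pow_add]; exact Submodule.mul_mem_mul hτ ht'
      have := add_mem hcon h2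
      rwa [← add_mul, ← mul_add, ← mul_add, sub_add_cancel] at this
    · rw [← hmem, ← Submodule.Quotient.mk_eq_zero, Submodule.Quotient.mk_sub, sub_eq_zero]
      exact htt'.symm

end RankReduction

/-! ### Rank reduction -/

section RankReduction

variable {K L : Type*} [Field K] [AddCommGroup L] [Module K L]

theorem aeval_prod_X_sub_C_mem_pow {A : Type*} [Ring A] [Algebra K A] {S : Submodule K A}
    (h1 : (1 : A) ∈ S) {Z : A} {k : ℕ} (hZ : Z ∈ S ^ k) (s : Multiset K) :
    Polynomial.aeval Z (s.map fun a => Polynomial.X - Polynomial.C a).prod ∈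
      S ^ (Multiset.card s * k) := by
  induction s using Multiset.induction_on with
  | empty => simpa using one_mem_pow_zero S
  | cons a s ih =>
    rw [Multiset.map_cons, Multiset.prod_cons, map_mul, Multiset.card_cons, add_mul, one_mul,
      add_comm, pow_add]
    refine Submodule.mul_mem_mul ?_ ih
    rw [map_sub, Polynomial.aeval_X, Polynomial.aeval_C, Algebra.algebraMap_eq_smul_one]
    exact sub_mem hZ (Submodule.smul_mem _ _ (pow_mono_of_one_mem h1 (Nat.zero_le k)
      (one_mem_pow_zero S)))

/-- If `P w P` is not a multiple of `P`, then a suitable product of `d - 1` factors `P w - μ`,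
multiplied by `P`, is nonzero and has rank at most `rank P / d`. The scalars are the roots, with
one omitted, of a monic polynomial `p` of least degree `d` with `p(P w) P = 0`. -/
theorem exists_aeval_mul_finrank_range_le [IsAlgClosed K] [FiniteDimensional K L] {P w : End K L}
    (hP : P * w * P ∉ Submodule.span K {P}) :
    ∃ s : Multiset K, 1 ≤ Multiset.card s ∧
      Polynomial.aeval (P * w) (s.map fun a => Polynomial.X - Polynomial.C a).prod * P ≠ 0 ∧
      (Multiset.card s + 1) * finrank K (LinearMap.range
        (Polynomial.aeval (P * w) (s.map fun a => Polynomial.X - Polynomial.C a).prod * P)) ≤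
        finrank K (LinearMap.range P) := by
  classical
  let T : Multiset K → End K L := fun s =>
    Polynomial.aeval (P * w) (s.map fun a => Polynomial.X - Polynomial.C a).prod
  have hTcons : ∀ a s, T (a ::ₘ s) = (P * w - algebraMap K _ a) * T s := by
    intro a s; simp [T]
  have hTadd : ∀ s t, T (s + t) = T s * T t := by intro s t; simp [T]
  have hcomm : ∀ p : Polynomial K, ∃ q : End K L, Polynomial.aeval (P * w) p * P = P * q := by
    intro p
    refine ⟨Polynomial.aeval (w * P) p, ?_⟩
    induction p using Polynomial.induction_on' with
    | add p q hp hq => rw [map_add, map_add, add_mul, mul_add, hp, hq]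
    | monomial n a =>
      rw [Polynomial.aeval_monomial, Polynomial.aeval_monomial, ← Algebra.smul_def,
        ← Algebra.smul_def, smul_mul_assoc, mul_smul_comm]
      congr 1
      induction n with
      | zero => simp
      | succ n ih => rw [pow_succ', mul_assoc, ih, pow_succ']; simp only [mul_assoc]
  have hex : ∃ d, ∃ s : Multiset K, Multiset.card s = d ∧ T s * P = 0 := by
    refine ⟨_, (minpoly K (P * w)).roots, rfl, ?_⟩
    have h := (IsAlgClosed.splits (minpoly K (P * w))).eq_prod_roots_of_monic
      (minpoly.monic (Algebra.IsIntegral.isIntegral (P * w)))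
    have : T (minpoly K (P * w)).roots = 0 := by
      simp only [T]
      rw [← h, minpoly.aeval]
    rw [this, zero_mul]
  obtain ⟨s, hs, hs0⟩ := Nat.find_spec hex
  have hmin : ∀ u : Multiset K, Multiset.card u < Multiset.card s → T u * P ≠ 0 := by
    intro u hu h0
    exact Nat.find_min hex (hs ▸ hu) ⟨u, rfl, h0⟩
  have hcard : 2 ≤ Multiset.card s := by
    by_contra! hlt
    apply hP
    rcases Nat.lt_or_ge (Multiset.card s) 1 with h | h
    · have : s = 0 := Multiset.card_eq_zero.mp (by omega)
      subst this
      have : P = 0 := by simpa [T] using hs0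
      simp [this]
    · obtain ⟨a, rfl⟩ := Multiset.card_eq_one.mp (show Multiset.card s = 1 by omega)
      have h2 : P * w * P - a • P = 0 := by
        simpa [T, sub_mul, Algebra.algebraMap_eq_smul_one] using hs0
      rw [sub_eq_zero] at h2
      exact Submodule.mem_span_singleton.mpr ⟨a, h2.symm⟩
  -- the ranks lost along the factors of `T s` bound the ranks of the products omitting a factor
  have hdrop : ∀ u ≤ s, finrank K (LinearMap.range (T u * P)) +
      (u.map fun a => finrank K (LinearMap.range (T (s.erase a) * P))).sum ≤
        finrank K (LinearMap.range P) := by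
    intro u
    induction u using Multiset.induction_on with
    | empty =>
      intro _
      have : T 0 = 1 := by simp [T]
      rw [this, one_mul]; simp
    | cons a u ih =>
      intro hu
      have ih := ih ((Multiset.le_cons_self u a).trans hu)
      rw [Multiset.map_cons, Multiset.sum_cons]
      have ha : a ∈ s := Multiset.mem_of_le hu (Multiset.mem_cons_self a u)
      have hue : u ≤ s.erase a := by
        have := Multiset.erase_le_erase a hu
        rwa [Multiset.erase_cons_head] at this
      have hsub : LinearMap.range (T (s.erase a) * P) ≤ LinearMap.range (T u * P) := by
        obtain ⟨v, hv⟩ := Multiset.le_iff_exists_add.mp hue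
        obtain ⟨q, hq⟩ := hcomm (v.map fun a => Polynomial.X - Polynomial.C a).prod
        rintro _ ⟨x, rfl⟩
        refine ⟨q x, ?_⟩
        change (T u * P * q) x = _
        rw [mul_assoc, ← hq, hv, hTadd, mul_assoc]
      have := finrank_map_add_finrank_le (P * w - algebraMap K _ a) hsub (by
        rintro _ ⟨x, rfl⟩
        change ((P * w - algebraMap K (End K L) a) * (T (s.erase a) * P)) x = 0
        rw [← mul_assoc, ← hTcons, Multiset.cons_erase ha, hs0, LinearMap.zero_apply])
      rw [← LinearMap.range_comp] at this
      have he : (P * w - algebraMap K (End K L) a) ∘ₗ (T u * P) = T (a ::ₘ u) * P := by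
        rw [hTcons, mul_assoc]; rfl
      rw [he] at this
      omega
  have hsum := hdrop s le_rfl
  have : ∃ a ∈ s, Multiset.card s * finrank K (LinearMap.range (T (s.erase a) * P)) ≤
      finrank K (LinearMap.range P) := by
    by_contra! hcon
    have h2 : Multiset.card (s.map fun a => Multiset.card s *
        finrank K (LinearMap.range (T (s.erase a) * P))) • (finrank K (LinearMap.range P) + 1) ≤
        (s.map fun a => Multiset.card s *
        finrank K (LinearMap.range (T (s.erase a) * P))).sum := by
      apply Multiset.card_nsmul_le_sum
      intro y hy
      obtain ⟨a, ha, rfl⟩ := Multiset.mem_map.mp hy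
      exact hcon a ha
    rw [Multiset.sum_map_mul_left, Multiset.card_map, smul_eq_mul] at h2
    have := Nat.le_of_mul_le_mul_left h2 (by omega)
    omega
  obtain ⟨a, ha, hle⟩ := this
  have hc := Multiset.card_erase_add_one ha
  exact ⟨s.erase a, by omega, hmin _ (by omega), by rw [hc]; exact hle⟩

/-- One step of the rank reduction: a word `P` of length `ℓ` with some `P w P` not a multiple of
`P` is replaced by a word of smaller rank, the growth in length being controlled by the drop in
rank. -/
theorem exists_finrank_range_lt [IsAlgClosed K] [FiniteDimensional K L]
    {S : Submodule K (End K L)} (h1 : 1 ∈ S) {P : End K L} {l : ℕ} (hP : P ∈ S ^ l)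
    (hns : ∃ j, ∃ w ∈ S ^ j, P * w * P ∉ Submodule.span K {P}) :
    ∃ l', ∃ Q ∈ S ^ l', Q ≠ 0 ∧
      ((2 * finrank K (LinearMap.range Q) ≤ finrank K (LinearMap.range P) ∧
        ∃ b h, l' ≤ 2 * l + b + h ∧ b * finrank K (LinearMap.range Q) ≤ finrank K L ∧
          h * finrank K (LinearMap.range P) ≤ finrank K L) ∨
      ∃ d j, 1 ≤ d ∧ (d + 1) * finrank K (LinearMap.range Q) ≤ finrank K (LinearMap.range P) ∧
        l' = (d + 1) * l + d * j ∧ j * finrank K (LinearMap.range P) ≤ 3 * finrank K L) := by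
  classical
  set j := Nat.find hns with hjdef
  obtain ⟨w₀, hw₀, hw₀'⟩ := Nat.find_spec hns
  have hsc : ∀ i < j, ∀ w ∈ S ^ i, P * w * P ∈ Submodule.span K {P} := by
    intro i hi w hw
    by_contra hcon
    exact Nat.find_min hns hi ⟨w, hw, hcon⟩
  have hP0 : P ≠ 0 := by rintro rfl; simp at hw₀'
  set N := finrank K L
  set r := finrank K (LinearMap.range P)
  have hr : 0 < r := by
    rw [Module.finrank_pos_iff, Submodule.nontrivial_iff_ne_bot]
    simpa [LinearMap.range_eq_bot] using hP0
  have hB : j * r ≤ 3 * N → ∃ l', ∃ Q ∈ S ^ l', Q ≠ 0 ∧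
      ∃ d j, 1 ≤ d ∧ (d + 1) * finrank K (LinearMap.range Q) ≤ r ∧
        l' = (d + 1) * l + d * j ∧ j * r ≤ 3 * N := by
    intro hj
    obtain ⟨s, hs, hne, hle⟩ := exists_aeval_mul_finrank_range_le hw₀'
    refine ⟨(Multiset.card s + 1) * l + Multiset.card s * j, _, ?_, hne, Multiset.card s, j, hs,
      hle, rfl, hj⟩
    have hZ : P * w₀ ∈ S ^ (l + j) := by
      rw [pow_add]; exact Submodule.mul_mem_mul hP hw₀
    have := Submodule.mul_mem_mul (aeval_prod_X_sub_C_mem_pow h1 hZ s) hP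
    rw [← pow_add] at this
    convert this using 2
    ring
  have hB' : j * r ≤ 3 * N → ∃ l', ∃ Q ∈ S ^ l', Q ≠ 0 ∧
      ((2 * finrank K (LinearMap.range Q) ≤ r ∧
        ∃ b h, l' ≤ 2 * l + b + h ∧ b * finrank K (LinearMap.range Q) ≤ N ∧ h * r ≤ N) ∨
      ∃ d j, 1 ≤ d ∧ (d + 1) * finrank K (LinearMap.range Q) ≤ r ∧
        l' = (d + 1) * l + d * j ∧ j * r ≤ 3 * N) := by
    intro hj
    obtain ⟨l', Q, hQ, hne, h⟩ := hB hj
    exact ⟨l', Q, hQ, hne, Or.inr h⟩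
  -- the three cases: `j` is small, the return word halves the rank, or `j` is at most `3 N / r`
  set h := N / r with hh
  have hhr : h * r ≤ N := Nat.div_mul_le_self N r
  have hhr' : N < (h + 1) * r := by
    rw [mul_comm]; exact Nat.lt_mul_div_succ N hr
  rcases Nat.lt_or_ge h j with hj | hj
  swap
  · exact hB' ((Nat.mul_le_mul_right r hj).trans (by omega))
  obtain ⟨i, hi, ρ, hρ, τ, hτ, hne, hzero⟩ := exists_annihilated_factor h1 hj hhr' hsc hw₀ hw₀'
  have hex : ∃ b, ∃ w ∈ S ^ b, P * (w * ρ) * P ≠ 0 := by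
    refine ⟨j - i, τ, hτ, fun h0 => hne ?_⟩
    rw [h0]; exact zero_mem _
  set b := Nat.find hex
  have hbhi : b ≤ j - i := Nat.find_min' hex ⟨τ, hτ, fun h0 => hne (h0 ▸ zero_mem _)⟩
  have hblo : j - h ≤ b := by
    by_contra! hlt
    obtain ⟨w, hw, hw'⟩ := Nat.find_spec hex
    exact hw' (hzero w (pow_mono_of_one_mem h1 (show b ≤ j - 1 - h by omega) hw))
  obtain ⟨w, hw, ⟨x, ⟨y, ⟨z, rfl⟩, rfl⟩, hwx⟩, hdim⟩ :=
    exists_first_return S h1 P b ((LinearMap.range P).map ρ)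
    (by
      rintro a ha w hw _ ⟨_, ⟨z, rfl⟩, rfl⟩
      have : P * (w * ρ) * P = 0 := by
        by_contra hcon
        exact Nat.find_min hex ha ⟨w, hw, hcon⟩
      exact congrArg (fun f : End K L => f z) this)
    (by
      obtain ⟨w, hw, hw'⟩ := Nat.find_spec hex
      by_contra! hcon
      apply hw'
      ext z
      exact hcon w hw _ ⟨P z, ⟨z, rfl⟩, rfl⟩)
  set Q := P * (w * ρ) * P with hQ
  have hQrange : ((LinearMap.range P).map ρ).map (P * w) = LinearMap.range Q := by
    rw [← LinearMap.range_comp, ← LinearMap.range_comp]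
    rfl
  rw [hQrange] at hdim
  have hbm : b * finrank K (LinearMap.range Q) ≤ N := by omega
  rcases Nat.lt_or_ge r (2 * finrank K (LinearMap.range Q)) with hm | hm
  · apply hB'
    have hb2 : b * r ≤ 2 * N := by nlinarith
    have : j * r ≤ (b + h) * r := Nat.mul_le_mul_right r (by omega)
    nlinarith
  · refine ⟨l + (b + i) + l, Q, ?_, ?_, Or.inl ⟨hm, b, h, by omega, hbm, hhr⟩⟩
    · rw [pow_add, pow_add, pow_add]
      exact Submodule.mul_mem_mul (Submodule.mul_mem_mul hP (Submodule.mul_mem_mul hw hρ)) hP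
    · intro h0
      apply hwx
      exact congrArg (fun f : End K L => f z) h0

/-- The length estimate for a step that replaces `P` by some `P w P` of at most half its rank. -/
theorem four_mul_logb_two_add_le {x y : ℝ} (hx : 1 ≤ x) (hxy : 2 * x ≤ y) :
    4 * (x * Real.logb 2 x) + x + y ≤ 2 * (y * Real.logb 2 y) := by
  have hy0 : 0 < y := by linarith
  have h1 : Real.logb 2 x + 1 ≤ Real.logb 2 y := by
    have h2 : Real.logb 2 (2 * x) = 1 + Real.logb 2 x := by
      rw [Real.logb_mul (by norm_num) (by linarith), Real.logb_self_eq_one (by norm_num)]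
    have := Real.logb_le_logb_of_le (b := 2) (by norm_num) (by linarith) hxy
    linarith
  have h0 : 0 ≤ Real.logb 2 x := Real.logb_nonneg (by norm_num) hx
  have h3 : y * (Real.logb 2 x + 1) ≤ y * Real.logb 2 y := mul_le_mul_of_nonneg_left h1 hy0.le
  have h4 : 2 * x * Real.logb 2 x ≤ y * Real.logb 2 x := mul_le_mul_of_nonneg_right hxy h0
  nlinarith

/-- The length estimate for a step that divides the rank by `d + 1`. -/
theorem three_mul_le_two_mul_logb (d : ℕ) (hd : 1 ≤ d) :
    3 * (d : ℝ) ≤ 2 * (((d : ℝ) + 1) * Real.logb 2 ((d : ℝ) + 1)) := by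
  rcases Nat.lt_or_ge d 2 with h | h
  · have : d = 1 := by omega
    subst this
    norm_num
  · have hd2 : (2 : ℝ) ≤ d := by exact_mod_cast h
    have h32 : (3 / 2 : ℝ) ≤ Real.logb 2 3 := by
      rw [Real.le_logb_iff_rpow_le (by norm_num) (by norm_num)]
      rw [show (3 / 2 : ℝ) = 1 + 1 / 2 by norm_num, Real.rpow_add (by norm_num), Real.rpow_one,
        ← Real.sqrt_eq_rpow]
      nlinarith [Real.sq_sqrt (show (0 : ℝ) ≤ 2 by norm_num), Real.sqrt_nonneg (2 : ℝ)]
    have : Real.logb 2 3 ≤ Real.logb 2 ((d : ℝ) + 1) :=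
      Real.logb_le_logb_of_le (by norm_num) (by norm_num) (by linarith)
    nlinarith

theorem mul_logb_two_mono {x y : ℝ} (hx : 1 ≤ x) (hxy : x ≤ y) :
    2 * (x * Real.logb 2 x) ≤ 2 * (y * Real.logb 2 y) := by
  have h0 : 0 ≤ Real.logb 2 x := Real.logb_nonneg (by norm_num) hx
  have := Real.logb_le_logb_of_le (b := 2) (by norm_num) (by linarith) hxy
  have := mul_le_mul hxy this h0 (by linarith)
  linarith

/-- Among the words of length at most `2 N log₂ N` in a space `S` of endomorphisms of an
`N`-dimensional space there is a nonzero one, `P`, such that `P w P` is a multiple of `P` for every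
word `w` of any length. -/
theorem exists_mul_mul_mem_span [IsAlgClosed K] [FiniteDimensional K L] [Nontrivial L]
    (S : Submodule K (End K L)) (h1 : 1 ∈ S) :
    ∃ l : ℕ, (l : ℝ) ≤ 2 * (finrank K L * Real.logb 2 (finrank K L)) ∧ ∃ P ∈ S ^ l, P ≠ 0 ∧
      ∀ i, ∀ w ∈ S ^ i, P * w * P ∈ Submodule.span K {P} := by
  have hN : 0 < finrank K L := Module.finrank_pos
  have hNR : (0 : ℝ) < finrank K L := by exact_mod_cast hN
  have hpos : ∀ P : End K L, P ≠ 0 → 0 < finrank K (LinearMap.range P) := by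
    intro P hP
    rw [Module.finrank_pos_iff, Submodule.nontrivial_iff_ne_bot]
    simpa [LinearMap.range_eq_bot] using hP
  -- the invariant: the length is at most `2 x log₂ x` with `x = N / rank P`
  have main : ∀ r : ℕ, ∀ (l : ℕ) (P : End K L), P ∈ S ^ l → P ≠ 0 →
      finrank K (LinearMap.range P) = r →
      (l : ℝ) ≤ 2 * ((finrank K L / r : ℝ) * Real.logb 2 (finrank K L / r : ℝ)) →
      ∃ l : ℕ, (l : ℝ) ≤ 2 * (finrank K L * Real.logb 2 (finrank K L)) ∧ ∃ P ∈ S ^ l, P ≠ 0 ∧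
        ∀ i, ∀ w ∈ S ^ i, P * w * P ∈ Submodule.span K {P} := by
    intro r
    induction r using Nat.strong_induction_on with
    | _ r ih =>
    intro l P hP hP0 hr hl
    have hr0 : 0 < r := hr ▸ hpos P hP0
    have hrR : (0 : ℝ) < r := by exact_mod_cast hr0
    have hrN : r ≤ finrank K L := hr ▸ Submodule.finrank_le _
    have hrNR : (r : ℝ) ≤ finrank K L := by exact_mod_cast hrN
    have hx1 : (1 : ℝ) ≤ finrank K L / r := by rwa [le_div_iff₀ hrR, one_mul]
    by_cases hns : ∃ j, ∃ w ∈ S ^ j, P * w * P ∉ Submodule.span K {P}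
    · obtain ⟨l', Q, hQ, hQ0, hcase⟩ := exists_finrank_range_lt h1 hP hns
      have hm0 := hpos Q hQ0
      set m := finrank K (LinearMap.range Q) with hm
      have hmR : (0 : ℝ) < m := by exact_mod_cast hm0
      rw [hr] at hcase
      rcases hcase with ⟨h2, b, h, hl', hb, hh⟩ | ⟨d, j, hd, hdm, hl', hj⟩
      · refine ih m (by omega) l' Q hQ hQ0 hm.symm ?_
        have h2R : 2 * (m : ℝ) ≤ r := by exact_mod_cast h2
        have hxy : 2 * (finrank K L / r : ℝ) ≤ finrank K L / m := by
          rw [← mul_div_assoc, div_le_div_iff₀ hrR hmR]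
          nlinarith
        have hbR : (b : ℝ) ≤ finrank K L / m := by
          rw [le_div_iff₀ hmR]; exact_mod_cast hb
        have hhR : (h : ℝ) ≤ finrank K L / r := by
          rw [le_div_iff₀ hrR]; exact_mod_cast hh
        have hl'R : (l' : ℝ) ≤ 2 * l + b + h := by exact_mod_cast hl'
        have := four_mul_logb_two_add_le hx1 hxy
        linarith
      · have hmr : m < r := by nlinarith
        refine ih m hmr l' Q hQ hQ0 hm.symm ?_
        set x : ℝ := finrank K L / r
        have hdR : (1 : ℝ) ≤ d := by exact_mod_cast hd
        have hxy : ((d : ℝ) + 1) * x ≤ finrank K L / m := by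
          have hdmR : ((d : ℝ) + 1) * m ≤ r := by exact_mod_cast hdm
          simp only [x]
          rw [← mul_div_assoc, div_le_div_iff₀ hrR hmR]
          nlinarith
        have hjR : (j : ℝ) ≤ 3 * x := by
          simp only [x]
          rw [← mul_div_assoc, le_div_iff₀ hrR]; exact_mod_cast hj
        have hl'R : (l' : ℝ) = (d + 1) * l + d * j := by exact_mod_cast hl'
        have hdx1 : (1 : ℝ) ≤ ((d : ℝ) + 1) * x := by nlinarith
        have h3 := mul_logb_two_mono hdx1 hxy
        rw [Real.logb_mul (by linarith) (by linarith)] at h3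
        have h4 := three_mul_le_two_mul_logb d hd
        have h5 : ((d : ℝ) + 1) * l ≤ (d + 1) * (2 * (x * Real.logb 2 x)) :=
          mul_le_mul_of_nonneg_left hl (by linarith)
        have h6 : (d : ℝ) * j ≤ d * (3 * x) := mul_le_mul_of_nonneg_left hjR (by linarith)
        have h7 := mul_le_mul_of_nonneg_right h4 (show 0 ≤ x by linarith)
        rw [hl'R]
        linarith
    · push Not at hns
      refine ⟨l, hl.trans (mul_logb_two_mono hx1 ?_), P, hP, hP0, hns⟩
      rw [div_le_iff₀ hrR]
      have : (1 : ℝ) ≤ r := by exact_mod_cast hr0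
      nlinarith
  refine main (finrank K L) 0 1 (one_mem_pow_zero S) one_ne_zero ?_ ?_
  · rw [Module.End.one_eq_id, LinearMap.range_id, finrank_top]
  · rw [div_self hNR.ne', Real.logb_one]; simp

end RankReduction

/-! ### Semisimple modules -/

section SemisimpleModules

universe u v

variable {K : Type*} {A : Type v} [Field K] [Ring A]

section

variable [Algebra K A] {L : Type*} [AddCommGroup L] [Module K L] [Module A L] [IsScalarTower K A L]

/-- Every vector reached from `x` by the algebra generated by `S` is already reached by words of
length `dim L`. -/
theorem exists_mem_pow_smul_eq [FiniteDimensional K L] {S : Submodule K A} (h1 : (1 : A) ∈ S)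
    (hS : ∀ a : A, ∃ i, a ∈ S ^ i) (x : L) (a : A) :
    ∃ w ∈ S ^ finrank K L, w • x = a • x := by
  let ev : A →ₗ[K] L := (LinearMap.toSpanSingleton A L x).restrictScalars K
  have hev : ∀ a, ev a = a • x := fun a => rfl
  let F : ℕ → Submodule K L := fun i => (S ^ i).map ev
  have hmono : ∀ i k, i ≤ k → F i ≤ F k := fun i k h =>
    Submodule.map_mono (pow_mono_of_one_mem h1 h)
  have hstab : ∀ i, F (i + 1) ≤ F i → F (i + 2) ≤ F (i + 1) := by
    rintro i hi _ ⟨w, hw, rfl⟩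
    rw [show i + 2 = 1 + (i + 1) by ring, pow_add, pow_one] at hw
    have : S * S ^ (i + 1) ≤ (F (i + 1)).comap ev := by
      rw [Submodule.mul_le]
      intro s hs t ht
      obtain ⟨t', ht', h⟩ := hi ⟨t, ht, rfl⟩
      refine ⟨s * t', ?_, ?_⟩
      · rw [show i + 1 = 1 + i by ring, pow_add, pow_one]
        exact Submodule.mul_mem_mul hs ht'
      · rw [hev, hev, mul_smul, mul_smul]
        rw [hev, hev] at h
        rw [h]
    exact this hw
  have hex : ∃ i ≤ finrank K L, F (i + 1) ≤ F i := by
    by_contra! hcon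
    have : ∀ i ≤ finrank K L + 1, i ≤ finrank K (F i) := by
      intro i
      induction i with
      | zero => intro _; omega
      | succ i ih =>
        intro hi
        have h := ih (by omega)
        have hlt : F i < F (i + 1) := lt_of_le_not_ge (hmono _ _ (by omega)) (hcon i (by omega))
        have := Submodule.finrank_lt_finrank_of_lt hlt
        omega
    have h2 := this _ le_rfl
    have := Submodule.finrank_le (F (finrank K L + 1))
    omega
  obtain ⟨i, hi, hle⟩ := hex
  have hall : ∀ k, F (i + k + 1) ≤ F (i + k) ∧ F (i + k) ≤ F i := by
    intro k
    induction k with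
    | zero => exact ⟨hle, le_rfl⟩
    | succ k ih => exact ⟨hstab _ ih.1, ih.1.trans ih.2⟩
  obtain ⟨k, hk⟩ := hS a
  have : ev a ∈ F (finrank K L) :=
    hmono i _ hi ((hall k).2 ⟨a, pow_mono_of_one_mem h1 (Nat.le_add_left k i) hk, rfl⟩)
  obtain ⟨w, hw, h⟩ := this
  exact ⟨w, hw, h⟩

/-- If `p` annihilates the submodule generated by `q • p • x`, then `q • p • x = 0`: in a complement
of that submodule, `x` has a component with the same image under `p`. -/
theorem smul_smul_eq_zero_of_forall [IsSemisimpleRing A] {q p : A} {x : L}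
    (h : ∀ a : A, p • a • q • p • x = 0) : q • p • x = 0 := by
  obtain ⟨C, hC⟩ := exists_isCompl (Submodule.span A {q • p • x})
  have htop : x ∈ Submodule.span A {q • p • x} ⊔ C := by rw [hC.sup_eq_top]; trivial
  obtain ⟨r, hr, y, hy, hxy⟩ := Submodule.mem_sup.mp htop
  obtain ⟨a, rfl⟩ := Submodule.mem_span_singleton.mp hr
  have h2 : q • p • x = q • p • y := by
    conv_lhs => rw [← hxy]
    rw [smul_add, h, zero_add]
  have h3 : q • p • x ∈ Submodule.span A {q • p • x} ⊓ C :=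
    ⟨Submodule.mem_span_singleton_self _, h2 ▸ C.smul_mem _ (C.smul_mem _ hy)⟩
  rwa [hC.inf_eq_bot] at h3

/-- A short word acting as a nonzero idempotent `e` such that `e A e` acts by multiples of `e`. -/
theorem exists_idempotent_smul [IsAlgClosed K] [IsSemisimpleRing A] [FiniteDimensional K L]
    [Nontrivial L] {S : Submodule K A} (h1 : (1 : A) ∈ S) (hS : ∀ a : A, ∃ i, a ∈ S ^ i) {D : ℕ}
    (hD : 2 * (finrank K L * Real.logb 2 (finrank K L)) + finrank K L ≤ D) :
    ∃ e ∈ S ^ D, (∃ x : L, e • x ≠ 0) ∧ (∀ x : L, e • e • x = e • x) ∧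
      ∀ a : A, ∃ c : K, ∀ x : L, e • a • e • x = c • e • x := by
  let ρ : A →ₐ[K] End K L := Algebra.lsmul K K L
  obtain ⟨l, hl, P, hP, hP0, hstuck⟩ := exists_mul_mul_mem_span (S.map ρ.toLinearMap)
    ⟨1, h1, map_one ρ⟩
  rw [← Submodule.map_pow] at hP
  obtain ⟨p, hp, rfl⟩ := hP
  have hstuck' : ∀ a : A, ∃ c : K, ∀ x : L, p • a • p • x = c • p • x := by
    intro a
    obtain ⟨i, hi⟩ := hS a
    have := hstuck i (ρ a) (by rw [← Submodule.map_pow]; exact ⟨a, hi, rfl⟩)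
    obtain ⟨c, hc⟩ := Submodule.mem_span_singleton.mp this
    exact ⟨c, fun x => (congrArg (fun f : End K L => f x) hc).symm⟩
  have hx : ∃ x : L, p • x ≠ 0 := by
    by_contra! hcon
    exact hP0 (LinearMap.ext hcon)
  obtain ⟨x, hx⟩ := hx
  have ha : ∃ a : A, p • a • p • x ≠ 0 := by
    by_contra! hcon
    apply hx
    simpa using smul_smul_eq_zero_of_forall (q := (1 : A)) (p := p) (x := x) (by simpa using hcon)
  obtain ⟨a, ha⟩ := ha
  obtain ⟨w, hw, hwa⟩ := exists_mem_pow_smul_eq h1 hS (p • x) a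
  rw [← hwa] at ha
  obtain ⟨c, hc⟩ := hstuck' w
  have hc0 : c ≠ 0 := by
    rintro rfl
    rw [hc, zero_smul] at ha
    exact ha rfl
  have he : ∀ y : L, (c⁻¹ • (w * p)) • y = c⁻¹ • w • p • y := by
    intro y; rw [smul_assoc, mul_smul]
  have hlD : finrank K L + l ≤ D := by
    have : ((finrank K L + l : ℕ) : ℝ) ≤ D := by push_cast; linarith
    exact_mod_cast this
  refine ⟨c⁻¹ • (w * p), ?_, ⟨x, ?_⟩, fun y => ?_, fun b => ?_⟩
  · apply Submodule.smul_mem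
    apply pow_mono_of_one_mem h1 hlD
    rw [pow_add]
    exact Submodule.mul_mem_mul hw hp
  · rw [he]
    intro h
    rcases smul_eq_zero.mp h with h | h
    · exact inv_ne_zero hc0 h
    · rw [h, smul_zero] at ha
      exact ha rfl
  · rw [he, he]
    rw [smul_comm p c⁻¹, smul_comm w c⁻¹, hc, smul_comm w c, smul_smul c⁻¹ c, inv_mul_cancel₀ hc0,
      one_smul]
  · obtain ⟨d, hd⟩ := hstuck' (b * w)
    refine ⟨c⁻¹ * d, fun y => ?_⟩
    have := hd y
    rw [mul_smul] at this
    rw [he, he, smul_comm b c⁻¹, smul_comm p c⁻¹, this]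
    simp only [smul_comm w, smul_smul]
    congr 1
    ring

end

section

variable {M N : Type*} [AddCommGroup M] [Module K M] [Module A M]
  [AddCommGroup N] [Module K N] [Module A N]

/-- If `e` fixes `x` and `y` and `e A e` acts by the same scalars on both, the cyclic submodules
generated by `x` and `y` are isomorphic, because `x` and `y` have the same annihilator. -/
theorem nonempty_linearEquiv_span_singleton [IsSemisimpleRing A] {e : A} {x : M} {y : N}
    (hx : e • x = x) (hy : e • y = y) (hx0 : x ≠ 0) (hy0 : y ≠ 0)
    (he : ∀ a : A, ∃ c : K, e • a • e • x = c • e • x ∧ e • a • e • y = c • e • y) :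
    Nonempty (Submodule.span A {x} ≃ₗ[A] Submodule.span A {y}) := by
  have hxy : ∀ a : A, a • x = 0 → a • y = 0 := by
    intro a ha
    by_contra hay
    apply hay
    rw [← hy]
    apply smul_smul_eq_zero_of_forall
    intro b
    obtain ⟨c, hcx, hcy⟩ := he (b * a)
    rw [mul_smul, hx, ha, smul_zero, smul_zero] at hcx
    have : c = 0 := (smul_eq_zero.mp hcx.symm).resolve_right hx0
    rw [mul_smul, this, zero_smul] at hcy
    exact hcy
  have hyx : ∀ a : A, a • y = 0 → a • x = 0 := by
    intro a ha
    by_contra hax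
    apply hax
    rw [← hx]
    apply smul_smul_eq_zero_of_forall
    intro b
    obtain ⟨c, hcx, hcy⟩ := he (b * a)
    rw [mul_smul, hy, ha, smul_zero, smul_zero] at hcy
    have : c = 0 := (smul_eq_zero.mp hcy.symm).resolve_right hy0
    rw [mul_smul, this, zero_smul] at hcx
    exact hcx
  have hker : LinearMap.ker (LinearMap.toSpanSingleton A M x) =
      LinearMap.ker (LinearMap.toSpanSingleton A N y) := by
    ext a; exact ⟨hxy a, hyx a⟩
  exact ⟨(LinearEquiv.ofEq _ _ (LinearMap.range_toSpanSingleton x).symm).trans <|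
    (LinearMap.quotKerEquivRange _).symm.trans <| (Submodule.quotEquivOfEq _ _ hker).trans <|
    (LinearMap.quotKerEquivRange _).trans <|
    LinearEquiv.ofEq _ _ (LinearMap.range_toSpanSingleton y)⟩

end

section

variable [Algebra K A] {M N : Type*} [AddCommGroup M] [Module K M] [Module A M]
  [IsScalarTower K A M] [AddCommGroup N] [Module K N] [Module A N] [IsScalarTower K A N]

theorem conj_lsmul (φ : M ≃ₗ[A] N) (f : A) :
    (φ.restrictScalars K).conj (Algebra.lsmul K K M f) = Algebra.lsmul K K N f := by
  ext y
  simp [LinearEquiv.conj_apply]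

theorem trace_lsmul_congr (φ : M ≃ₗ[A] N) (f : A) :
    LinearMap.trace K M (Algebra.lsmul K K M f) = LinearMap.trace K N (Algebra.lsmul K K N f) := by
  rw [← conj_lsmul φ, LinearMap.trace_conj']

variable [FiniteDimensional K M] [FiniteDimensional K N]

theorem charpoly_lsmul_congr (φ : M ≃ₗ[A] N) (f : A) :
    (Algebra.lsmul K K M f).charpoly = (Algebra.lsmul K K N f).charpoly := by
  rw [← conj_lsmul φ, LinearEquiv.charpoly_conj]

theorem charpoly_lsmul_prod (f : A) :
    (Algebra.lsmul K K (M × N) f).charpoly =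
      (Algebra.lsmul K K M f).charpoly * (Algebra.lsmul K K N f).charpoly := by
  rw [← LinearMap.charpoly_prodMap]; rfl

theorem trace_lsmul_prod (f : A) :
    LinearMap.trace K (M × N) (Algebra.lsmul K K (M × N) f) =
      LinearMap.trace K M (Algebra.lsmul K K M f) +
        LinearMap.trace K N (Algebra.lsmul K K N f) := by
  rw [← LinearMap.trace_prodMap']; rfl

theorem eq_zero_of_idempotent_of_charpoly_eq {f : End K M} (hf : ∀ x, f (f x) = f x)
    (h : f.charpoly = (0 : End K N).charpoly) : f = 0 := by
  have hne : IsIdempotentElem f := LinearMap.ext hf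
  rw [LinearMap.charpoly_zero] at h
  have hd : finrank K M = finrank K N := by
    rw [← LinearMap.charpoly_natDegree f, h, Polynomial.natDegree_X_pow]
  have h0 := LinearMap.aeval_self_charpoly f
  rw [h, map_pow, Polynomial.aeval_X] at h0
  rcases Nat.eq_zero_or_pos (finrank K N) with hz | hz
  · have : Subsingleton M := Module.finrank_zero_iff.mp (hd.trans hz)
    exact Subsingleton.elim _ _
  · rwa [hne.pow_eq (by omega)] at h0

end

/-- Two modules over a semisimple algebra generated by `S` are isomorphic as soon as the words of
length `D` in `S` have equal characteristic polynomials on them, or, in characteristic zero, equal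
traces; here `D ≥ 2 N log₂ N + N` with `N` the sum of the dimensions. -/
theorem nonempty_linearEquiv_of_charpoly_eq_or_trace_eq [Algebra K A] [IsAlgClosed K]
    [IsSemisimpleRing A] {S : Submodule K A} (h1 : (1 : A) ∈ S) (hS : ∀ a : A, ∃ i, a ∈ S ^ i)
    {D : ℕ} (k : ℕ) :
    ∀ (M N : Type u) [AddCommGroup M] [Module K M] [Module A M] [IsScalarTower K A M]
      [AddCommGroup N] [Module K N] [Module A N] [IsScalarTower K A N]
      [FiniteDimensional K M] [FiniteDimensional K N],
      finrank K M + finrank K N = k →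
      2 * ((k : ℝ) * Real.logb 2 k) + k ≤ D →
      ((∀ f ∈ S ^ D, (Algebra.lsmul K K M f).charpoly = (Algebra.lsmul K K N f).charpoly) ∨
        (CharZero K ∧ ∀ f ∈ S ^ D, LinearMap.trace K M (Algebra.lsmul K K M f) =
          LinearMap.trace K N (Algebra.lsmul K K N f))) →
      Nonempty (M ≃ₗ[A] N) := by
  induction k using Nat.strong_induction_on with
  | _ k ih =>
  intro M N _ _ _ _ _ _ _ _ _ _ hk hD hyp
  rcases Nat.eq_zero_or_pos k with hk0 | hk0
  · have : Subsingleton M := Module.finrank_zero_iff.mp (show finrank K M = 0 by omega)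
    have : Subsingleton N := Module.finrank_zero_iff.mp (show finrank K N = 0 by omega)
    exact ⟨0⟩
  have hfr : finrank K (M × N) = k := by rw [Module.finrank_prod, hk]
  have : Nontrivial (M × N) := Module.finrank_pos_iff.mp (hfr ▸ hk0)
  obtain ⟨e, heD, ⟨z, hz⟩, hee, hsc⟩ := exists_idempotent_smul (L := M × N) h1 hS
    (D := D) (by rw [hfr]; exact hD)
  have heM : ∀ x : M, e • e • x = e • x := fun x => congrArg Prod.fst (hee (x, 0))
  have heN : ∀ y : N, e • e • y = e • y := fun y => congrArg Prod.snd (hee (0, y))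
  have hiM : IsIdempotentElem (Algebra.lsmul K K M e) := LinearMap.ext heM
  have hiN : IsIdempotentElem (Algebra.lsmul K K N e) := LinearMap.ext heN
  have hMN : Algebra.lsmul K K M e = 0 ↔ Algebra.lsmul K K N e = 0 := by
    rcases hyp with hyp | ⟨h0, hyp⟩
    · have := hyp e heD
      exact ⟨fun h => eq_zero_of_idempotent_of_charpoly_eq heN (this.symm.trans (by rw [h])),
        fun h => eq_zero_of_idempotent_of_charpoly_eq heM (this.trans (by rw [h]))⟩
    · rw [← LinearMap.IsIdempotentElem.trace_eq_zero_iff hiM,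
        ← LinearMap.IsIdempotentElem.trace_eq_zero_iff hiN, hyp e heD]
  have hM0 : Algebra.lsmul K K M e ≠ 0 := by
    intro h
    apply hz
    have h' := hMN.mp h
    exact Prod.ext (congrArg (fun f : End K M => f z.1) h) (congrArg (fun f : End K N => f z.2) h')
  have hN0 : Algebra.lsmul K K N e ≠ 0 := fun h => hM0 (hMN.mpr h)
  obtain ⟨x, hx⟩ : ∃ x : M, e • x ≠ 0 := by
    by_contra! hcon; exact hM0 (LinearMap.ext hcon)
  obtain ⟨y, hy⟩ : ∃ y : N, e • y ≠ 0 := by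
    by_contra! hcon; exact hN0 (LinearMap.ext hcon)
  obtain ⟨φ⟩ := nonempty_linearEquiv_span_singleton (K := K) (heM x) (heN y) hx hy (by
    intro a
    obtain ⟨c, hc⟩ := hsc a
    exact ⟨c, congrArg Prod.fst (hc (e • x, e • y)), congrArg Prod.snd (hc (e • x, e • y))⟩)
  obtain ⟨M', hM'⟩ := exists_isCompl (Submodule.span A {e • x})
  obtain ⟨N', hN'⟩ := exists_isCompl (Submodule.span A {e • y})
  set R := Submodule.span A {e • x} with hR
  set R' := Submodule.span A {e • y}
  have hfin : ∀ Q : Submodule A M, FiniteDimensional K Q := fun Q =>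
    Module.Finite.of_injective (Q.subtype.restrictScalars K) Subtype.val_injective
  have hfin' : ∀ Q : Submodule A N, FiniteDimensional K Q := fun Q =>
    Module.Finite.of_injective (Q.subtype.restrictScalars K) Subtype.val_injective
  have := hfin R
  have := hfin M'
  have := hfin' R'
  have := hfin' N'
  let α := Submodule.prodEquivOfIsCompl R M' hM'
  let β := Submodule.prodEquivOfIsCompl R' N' hN'
  have hRpos : 0 < finrank K R := by
    have : Nontrivial R := ⟨⟨⟨e • x, Submodule.mem_span_singleton_self _⟩, 0,
      fun h => hx (congrArg Subtype.val h)⟩⟩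
    exact Module.finrank_pos
  have hdM : finrank K R + finrank K M' = finrank K M := by
    rw [← Module.finrank_prod]
    exact (α.restrictScalars K).finrank_eq
  have hdN : finrank K R' + finrank K N' = finrank K N := by
    rw [← Module.finrank_prod]
    exact (β.restrictScalars K).finrank_eq
  have hlt : finrank K M' + finrank K N' < k := by omega
  obtain ⟨ψ⟩ := ih _ hlt M' N' rfl (le_trans (by
      have hle : ((finrank K M' + finrank K N' : ℕ) : ℝ) ≤ k := by exact_mod_cast hlt.le
      rcases Nat.eq_zero_or_pos (finrank K M' + finrank K N') with h0 | h0
      · rw [h0]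
        have hk1 : (1 : ℝ) ≤ k := by exact_mod_cast hk0
        have := mul_nonneg (by linarith : (0 : ℝ) ≤ k) (Real.logb_nonneg (b := 2) (by norm_num) hk1)
        simp only [Nat.cast_zero, zero_mul, mul_zero, add_zero]
        linarith
      · have := mul_logb_two_mono (by exact_mod_cast h0) hle
        linarith) hD) (by
      rcases hyp with hyp | ⟨h0, hyp⟩
      · left
        intro f hf
        have h := hyp f hf
        rw [← charpoly_lsmul_congr α, ← charpoly_lsmul_congr β, charpoly_lsmul_prod,
          charpoly_lsmul_prod, charpoly_lsmul_congr φ] at h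
        exact mul_left_cancel₀ (LinearMap.charpoly_monic _).ne_zero h
      · right
        refine ⟨h0, fun f hf => ?_⟩
        have h := hyp f hf
        rw [← trace_lsmul_congr α, ← trace_lsmul_congr β, trace_lsmul_prod,
          trace_lsmul_prod, trace_lsmul_congr φ] at h
        exact add_left_cancel h)
  exact ⟨α.symm.trans ((LinearEquiv.prodCongr φ ψ).trans β)⟩

end SemisimpleModules

/-! ### Degeneration inside orbit closures -/

section OrbitClosures

variable {K : Type*} [Field K] {n m : ℕ}

theorem subset_zariskiClosure (S : Set (MatTuple K n m)) : S ⊆ zariskiClosure S :=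
  fun _ hX _ hf => hf _ hX

theorem conj_mul (g h : GL (Fin n) K) (X : MatTuple K n m) :
    conj (g * h) X = conj g (conj h X) := by
  funext i
  simp [conj, mul_assoc]

theorem self_mem_orbit (X : MatTuple K n m) : X ∈ orbit X :=
  ⟨1, by funext i; simp [conj]⟩

theorem exists_evalAt_eq_evalAt_conj (f : Poly K n m) (g : GL (Fin n) K) :
    ∃ f' : Poly K n m, ∀ X, evalAt f' X = evalAt f (conj g X) := by
  refine ⟨MvPolynomial.aeval (fun p : Fin m × Fin n × Fin n => ∑ k, ∑ l,
    MvPolynomial.C ((g : Matrix (Fin n) (Fin n) K) p.2.1 k) * MvPolynomial.X (p.1, k, l) *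
      MvPolynomial.C (((g⁻¹ : GL (Fin n) K) : Matrix (Fin n) (Fin n) K) l p.2.2)) f, fun X => ?_⟩
  rw [evalAt, MvPolynomial.aeval_def, MvPolynomial.eval_eval₂, evalAt, MvPolynomial.eval]
  congr 1
  · ext; simp
  · funext p
    simp only [conj, Matrix.mul_apply, Finset.sum_mul, map_sum, map_mul]
    rw [Finset.sum_comm]
    simp

theorem conj_mem_zariskiClosure_orbit {X Y : MatTuple K n m} (h : X ∈ zariskiClosure (orbit Y))
    (g : GL (Fin n) K) : conj g X ∈ zariskiClosure (orbit Y) := by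
  intro f hf
  obtain ⟨f', hf'⟩ := exists_evalAt_eq_evalAt_conj f g
  rw [← hf']
  apply h
  rintro _ ⟨h, rfl⟩
  rw [hf']
  exact hf _ ⟨g * h, conj_mul g h Y⟩

theorem zariskiClosure_orbit_trans {X Y Z : MatTuple K n m} (hZ : Z ∈ zariskiClosure (orbit X))
    (hX : X ∈ zariskiClosure (orbit Y)) : Z ∈ zariskiClosure (orbit Y) := by
  intro f hf
  apply hZ
  rintro _ ⟨g, rfl⟩
  exact conj_mem_zariskiClosure_orbit hX g f hf

theorem evalAt_eq_of_mem_zariskiClosure {f : Poly K n m} (hf : f ∈ invariantRing K n m)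
    {X X' : MatTuple K n m} (h : X' ∈ zariskiClosure (orbit X)) : evalAt f X' = evalAt f X := by
  have := h (f - MvPolynomial.C (evalAt f X)) (by
    rintro _ ⟨g, rfl⟩
    have := hf g X
    simp only [evalAt, map_sub, MvPolynomial.eval_C] at this ⊢
    rw [this, sub_self])
  simpa [evalAt, sub_eq_zero] using this

/-- The limit of `g_t · X` for `t → 0`, with `g_t = t p + (1 - p)` for an idempotent `p` whose
range is stable under `X`: the block-diagonal part of `X` lies in the closure of the orbit. -/
theorem blockDiagonal_mem_zariskiClosure [Infinite K] {X : MatTuple K n m}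
    {p : Matrix (Fin n) (Fin n) K} (hp : p * p = p) (hX : ∀ i, (1 - p) * X i * p = 0) :
    (fun i => p * X i * p + (1 - p) * X i * (1 - p)) ∈ zariskiClosure (orbit X) := by
  intro f hf
  set X' : MatTuple K n m := fun i => p * X i * p + (1 - p) * X i * (1 - p) with hX'
  let C : MatTuple K n m := fun i => p * X i * (1 - p)
  let q : Polynomial K := MvPolynomial.aeval
    (fun v : Fin m × Fin n × Fin n => Polynomial.C (X' v.1 v.2.1 v.2.2) +
      Polynomial.X * Polynomial.C (C v.1 v.2.1 v.2.2)) f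
  have hq : ∀ t, q.eval t = evalAt f (fun i => X' i + t • C i) := by
    intro t
    have : (Polynomial.evalRingHom t) q = evalAt f (fun i => X' i + t • C i) := by
      simp only [q]
      rw [MvPolynomial.aeval_def, MvPolynomial.hom_eval₂, evalAt, MvPolynomial.eval]
      congr 1
      · ext; simp
      · funext v; simp; ring
    simpa using this
  have h1p : (1 - p) * (1 - p) = 1 - p := by noncomm_ring; rw [hp]; abel
  have hp1 : p * (1 - p) = 0 := by rw [mul_sub, mul_one, hp, sub_self]
  have h1p' : (1 - p) * p = 0 := by rw [sub_mul, one_mul, hp, sub_self]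
  have horb : ∀ t : K, t ≠ 0 → (fun i => X' i + t • C i) ∈ orbit X := by
    intro t ht
    have hinv : ∀ s u : K, s * u = 1 → (s • p + (1 - p)) * (u • p + (1 - p)) = 1 := by
      intro s u hsu
      simp only [mul_add, add_mul, smul_mul_assoc, mul_smul_comm, hp, h1p, hp1, h1p', smul_zero,
        add_zero, zero_add]
      rw [smul_smul, mul_comm u s, hsu, one_smul, add_sub_cancel]
    refine ⟨⟨t • p + (1 - p), t⁻¹ • p + (1 - p), hinv _ _ (mul_inv_cancel₀ ht),
      hinv _ _ (inv_mul_cancel₀ ht)⟩, ?_⟩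
    funext i
    change (t • p + (1 - p)) * X i * (t⁻¹ • p + (1 - p)) = X' i + t • C i
    simp only [hX', C, mul_add, add_mul, smul_mul_assoc, mul_smul_comm, hX]
    rw [add_zero, smul_smul, inv_mul_cancel₀ ht, one_smul]
    abel
  have hq0 : q = 0 := by
    apply Polynomial.eq_zero_of_infinite_isRoot
    refine Set.Infinite.mono (s := {0}ᶜ) ?_ (Set.finite_singleton (0 : K)).infinite_compl
    intro t ht
    exact (hq t).trans (hf _ (horb t ht))
  have := hq 0
  rw [hq0, Polynomial.eval_zero] at this
  simpa using this.symm

/-- A nilpotent left ideal `A j` of the algebra generated by a tuple gives a stable subspace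
`A j Kⁿ`, and passing to the block-diagonal part for it kills `j`. -/
theorem exists_mem_zariskiClosure_finrank_lt [Infinite K] {X : MatTuple K n m}
    {j : Matrix (Fin n) (Fin n) K} (hj : j ∈ Algebra.adjoin K (Set.range X)) (hj0 : j ≠ 0)
    (hjj : ∀ a ∈ Algebra.adjoin K (Set.range X), j * a * j = 0) :
    ∃ X' ∈ zariskiClosure (orbit X), finrank K (Algebra.adjoin K (Set.range X')) <
      finrank K (Algebra.adjoin K (Set.range X)) := by
  set A := Algebra.adjoin K (Set.range X) with hA
  let W : Submodule K (Fin n → K) :=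
    Submodule.span K {y | ∃ a ∈ A, ∃ x, y = (a * j).mulVec x}
  obtain ⟨P, hP⟩ := W.subtype.exists_leftInverse_of_injective (Submodule.ker_subtype W)
  have hPW : ∀ y (hy : y ∈ W), (P y : Fin n → K) = y := by
    intro y hy
    exact congrArg Subtype.val (congrArg (fun φ => φ ⟨y, hy⟩) hP)
  let p : Matrix (Fin n) (Fin n) K := LinearMap.toMatrix' (W.subtype ∘ₗ P)
  have hpv : ∀ y, p.mulVec y = P y := by
    intro y
    rw [← Matrix.toLin'_apply, Matrix.toLin'_toMatrix']
    rfl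
  have hext : ∀ a b : Matrix (Fin n) (Fin n) K, (∀ x, a.mulVec x = b.mulVec x) → a = b := by
    intro a b h
    exact Matrix.toLin'.injective (LinearMap.ext fun x => by simpa using h x)
  have hp : p * p = p := by
    apply hext
    intro x
    rw [← Matrix.mulVec_mulVec, hpv, hpv, hPW _ (P x).2]
  have hstable : ∀ a ∈ A, (1 - p) * a * p = 0 := by
    intro a ha
    rw [mul_assoc, sub_mul, one_mul, sub_eq_zero]
    apply hext
    intro x
    rw [← Matrix.mulVec_mulVec x p, hpv (_), ← Matrix.mulVec_mulVec x a, hpv x]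
    symm
    apply hPW
    have : W ≤ W.comap a.toLin' := by
      simp only [W]
      rw [Submodule.span_le]
      rintro _ ⟨b, hb, y, rfl⟩
      apply Submodule.subset_span
      exact ⟨a * b, mul_mem ha hb, y, by simp [mul_assoc]⟩
    simpa using this (P x).2
  have hjp : j * p = 0 := by
    apply hext
    intro x
    rw [← Matrix.mulVec_mulVec, hpv, Matrix.zero_mulVec]
    have : W ≤ LinearMap.ker j.toLin' := by
      simp only [W]
      rw [Submodule.span_le]
      rintro _ ⟨b, hb, y, rfl⟩
      have := hjj b hb
      simp [Matrix.mulVec_mulVec, ← mul_assoc, this]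
    simpa using this (P x).2
  have hpj : (1 - p) * j = 0 := by
    rw [sub_mul, one_mul, sub_eq_zero]
    apply hext
    intro x
    rw [← Matrix.mulVec_mulVec, hpv]
    symm
    apply hPW
    exact Submodule.subset_span ⟨1, one_mem _, x, by simp⟩
  refine ⟨_, blockDiagonal_mem_zariskiClosure hp
    (fun i => hstable _ (Algebra.subset_adjoin ⟨i, rfl⟩)), ?_⟩
  set X' : MatTuple K n m := fun i => p * X i * p + (1 - p) * X i * (1 - p)
  let φ : End K (Matrix (Fin n) (Fin n) K) :=
    LinearMap.mulRight K p ∘ₗ LinearMap.mulLeft K p +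
      LinearMap.mulRight K (1 - p) ∘ₗ LinearMap.mulLeft K (1 - p)
  have hφ : ∀ a, φ a = p * a * p + (1 - p) * a * (1 - p) := fun a => rfl
  have hp1 : p * (1 - p) = 0 := by rw [mul_sub, mul_one, hp, sub_self]
  have h1p' : (1 - p) * p = 0 := by rw [sub_mul, one_mul, hp, sub_self]
  have hap : ∀ a ∈ A, a * p = p * a * p := by
    intro a ha
    have := hstable a ha
    rw [mul_assoc, sub_mul, one_mul, sub_eq_zero, ← mul_assoc] at this
    exact this
  have hpa : ∀ a ∈ A, (1 - p) * a = (1 - p) * a * (1 - p) := by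
    intro a ha
    rw [mul_sub, mul_one, hstable a ha, sub_zero]
  have h1p : (1 - p) * (1 - p) = 1 - p := by rw [mul_sub, mul_one, h1p', sub_zero]
  have hφmul : ∀ a ∈ A, ∀ b ∈ A, φ (a * b) = φ a * φ b := by
    intro a ha b hb
    have e1 : p * (a * b) * p = p * a * p * (p * b * p) := by
      calc p * (a * b) * p = p * a * (b * p) := by simp only [mul_assoc]
        _ = p * a * (p * b * p) := by rw [hap b hb]
        _ = p * a * (p * p * b * p) := by rw [hp]
        _ = _ := by simp only [mul_assoc]
    have e2 : (1 - p) * (a * b) * (1 - p) = (1 - p) * a * (1 - p) * ((1 - p) * b * (1 - p)) := by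
      calc (1 - p) * (a * b) * (1 - p) = (1 - p) * a * (b * (1 - p)) := by simp only [mul_assoc]
        _ = (1 - p) * a * (1 - p) * (b * (1 - p)) := by rw [← hpa a ha]
        _ = (1 - p) * a * ((1 - p) * (1 - p)) * (b * (1 - p)) := by rw [h1p]
        _ = _ := by simp only [mul_assoc]
    have e3 : p * a * p * ((1 - p) * b * (1 - p)) = 0 := by
      calc p * a * p * ((1 - p) * b * (1 - p)) = p * a * (p * (1 - p)) * (b * (1 - p)) := by
            simp only [mul_assoc]
        _ = 0 := by rw [hp1]; simp
    have e4 : (1 - p) * a * (1 - p) * (p * b * p) = 0 := by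
      calc (1 - p) * a * (1 - p) * (p * b * p) = (1 - p) * a * ((1 - p) * p) * (b * p) := by
            simp only [mul_assoc]
        _ = 0 := by rw [h1p']; simp
    rw [hφ, hφ, hφ, add_mul, mul_add, mul_add, e3, e4, ← e1, ← e2, add_zero, zero_add]
  have hle : Subalgebra.toSubmodule (Algebra.adjoin K (Set.range X')) ≤
      (Subalgebra.toSubmodule A).map φ := by
    intro b hb'
    have hb : b ∈ Algebra.adjoin K (Set.range X') := hb'
    clear hb'
    induction hb using Algebra.adjoin_induction with
    | mem x hx =>
      obtain ⟨i, rfl⟩ := hx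
      exact ⟨X i, Algebra.subset_adjoin ⟨i, rfl⟩, rfl⟩
    | algebraMap r =>
      refine ⟨algebraMap K _ r, algebraMap_mem A r, ?_⟩
      rw [Algebra.algebraMap_eq_smul_one, map_smul, hφ, mul_one, mul_one, hp, h1p, add_sub_cancel]
    | add x y _ _ hx hy => exact add_mem hx hy
    | mul x y _ _ hx hy =>
      obtain ⟨a, ha, rfl⟩ := hx
      obtain ⟨b, hb, rfl⟩ := hy
      exact ⟨a * b, A.mul_mem ha hb, hφmul a ha b hb⟩
  have h1 := Submodule.finrank_mono hle
  have h2 := finrank_map_add_finrank_le φ (W := Submodule.span K {j})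
    (W' := Subalgebra.toSubmodule A) (by
      rw [Submodule.span_le, Set.singleton_subset_iff]
      exact hj) (by
      intro x hx
      obtain ⟨c, rfl⟩ := Submodule.mem_span_singleton.mp hx
      rw [map_smul, hφ, mul_assoc, hjp, hpj]
      simp)
  rw [finrank_span_singleton hj0] at h2
  change finrank K (Subalgebra.toSubmodule (Algebra.adjoin K (Set.range X'))) <
    finrank K (Subalgebra.toSubmodule A)
  omega

/-- The closure of every orbit contains a tuple that generates a semiprime algebra. -/
theorem exists_mem_zariskiClosure_semiprime [Infinite K] (X : MatTuple K n m) :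
    ∃ X' ∈ zariskiClosure (orbit X), ∀ j ∈ Algebra.adjoin K (Set.range X'),
      (∀ a ∈ Algebra.adjoin K (Set.range X'), j * a * j = 0) → j = 0 := by
  classical
  have hex : ∃ d, ∃ X' ∈ zariskiClosure (orbit X),
      finrank K (Algebra.adjoin K (Set.range X')) = d :=
    ⟨_, X, subset_zariskiClosure _ (self_mem_orbit X), rfl⟩
  obtain ⟨X', hX', hd⟩ := Nat.find_spec hex
  refine ⟨X', hX', fun j hj hjj => ?_⟩
  by_contra hj0
  obtain ⟨Y, hY, hlt⟩ := exists_mem_zariskiClosure_finrank_lt hj hj0 hjj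
  exact Nat.find_min hex (hd ▸ hlt) ⟨Y, zariskiClosure_orbit_trans hY hX', rfl⟩

end OrbitClosures

theorem isSemisimpleRing_of_semiprime {R : Type*} [Ring R] [IsArtinianRing R]
    (h : ∀ j : R, (∀ a, j * a * j = 0) → j = 0) : IsSemisimpleRing R := by
  classical
  rw [IsArtinianRing.isSemisimpleRing_iff_jacobson]
  have hnil : ∃ k, Ring.jacobson R ^ k = ⊥ := IsSemiprimaryRing.isNilpotent
  by_contra hJ
  have hk := Nat.find_spec hnil
  set k := Nat.find hnil with hkdef
  have hk2 : 2 ≤ k := by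
    by_contra! hlt
    rcases Nat.lt_or_ge k 1 with h0 | h0
    · have hk0 : k = 0 := by omega
      rw [hk0, Submodule.pow_zero] at hk
      apply hJ
      rw [eq_bot_iff, ← hk]
      exact le_of_le_of_eq le_top Ideal.one_eq_top.symm
    · have hk1 : k = 1 := by omega
      rw [hk1, Submodule.pow_one] at hk
      exact hJ hk
  have hne : Ring.jacobson R ^ (k - 1) ≠ ⊥ := Nat.find_min hnil (by omega)
  apply hne
  rw [eq_bot_iff]
  intro j hj
  apply h
  intro a
  have h1 : j * (a * j) ∈ Ring.jacobson R ^ (k - 1) * Ring.jacobson R ^ (k - 1) :=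
    Ideal.mul_mem_mul hj (Ideal.mul_mem_left _ a hj)
  rw [← Submodule.pow_add _ (by omega)] at h1
  have h2 := Ideal.pow_le_pow_right (I := Ring.jacobson R) (show k ≤ k - 1 + (k - 1) by omega) h1
  rw [hk] at h2
  rw [mul_assoc]
  simpa using h2

/-! ### Invariants from generic matrices -/

section Invariants

variable {K : Type*} [Field K] {n m : ℕ}

/-- Evaluation of a matrix of polynomials at a tuple. -/
noncomputable def evalMatrix (X : MatTuple K n m) :
    Matrix (Fin n) (Fin n) (Poly K n m) →ₐ[K] Matrix (Fin n) (Fin n) K :=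
  (MvPolynomial.aeval fun v : Fin m × Fin n × Fin n => X v.1 v.2.1 v.2.2).mapMatrix

/-- The generic matrices, whose entries are the variables. -/
noncomputable def genericMatrix (K : Type*) [Field K] (n m : ℕ) (i : Fin m) :
    Matrix (Fin n) (Fin n) (Poly K n m) :=
  Matrix.of fun a b => MvPolynomial.X (i, a, b)

/-- The span of the identity and the generic matrices. -/
noncomputable def genericSpan (K : Type*) [Field K] (n m : ℕ) :
    Submodule K (Matrix (Fin n) (Fin n) (Poly K n m)) :=
  Submodule.span K (insert 1 (Set.range (genericMatrix K n m)))

theorem evalMatrix_apply (X : MatTuple K n m) (F : Matrix (Fin n) (Fin n) (Poly K n m))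
    (a b : Fin n) : evalMatrix X F a b = evalAt (F a b) X := by
  simp [evalMatrix, evalAt, MvPolynomial.aeval_eq_eval]

theorem evalMatrix_eq_map (X : MatTuple K n m) (F : Matrix (Fin n) (Fin n) (Poly K n m)) :
    evalMatrix X F = (MvPolynomial.eval fun v => X v.1 v.2.1 v.2.2).mapMatrix F := by
  ext a b
  rw [evalMatrix_apply]; rfl

theorem evalMatrix_genericMatrix (X : MatTuple K n m) (i : Fin m) :
    evalMatrix X (genericMatrix K n m i) = X i := by
  ext a b
  simp [evalMatrix_apply, genericMatrix, evalAt]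

theorem evalMatrix_conj {D : ℕ} {F : Matrix (Fin n) (Fin n) (Poly K n m)}
    (hF : F ∈ genericSpan K n m ^ D) (g : GL (Fin n) K) (X : MatTuple K n m) :
    evalMatrix (conj g X) F = (g : Matrix (Fin n) (Fin n) K) * evalMatrix X F *
      ((g⁻¹ : GL (Fin n) K) : Matrix (Fin n) (Fin n) K) := by
  have hg : ((g⁻¹ : GL (Fin n) K) : Matrix (Fin n) (Fin n) K) * g = 1 := by
    rw [← Units.val_mul, inv_mul_cancel, Units.val_one]
  have hg' : (g : Matrix (Fin n) (Fin n) K) * ((g⁻¹ : GL (Fin n) K) : Matrix (Fin n) (Fin n) K) =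
      1 := by
    rw [← Units.val_mul, mul_inv_cancel, Units.val_one]
  let E : Submodule K (Matrix (Fin n) (Fin n) (Poly K n m)) := LinearMap.eqLocus
    (evalMatrix (conj g X)).toLinearMap
    (LinearMap.mulRight K ((g⁻¹ : GL (Fin n) K) : Matrix (Fin n) (Fin n) K) ∘ₗ
      LinearMap.mulLeft K (g : Matrix (Fin n) (Fin n) K) ∘ₗ (evalMatrix X).toLinearMap)
  have hE : ∀ F, F ∈ E ↔ evalMatrix (conj g X) F = (g : Matrix (Fin n) (Fin n) K) *
      evalMatrix X F * ((g⁻¹ : GL (Fin n) K) : Matrix (Fin n) (Fin n) K) := fun F => Iff.rfl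
  have h1 : (1 : Matrix (Fin n) (Fin n) (Poly K n m)) ∈ E := by
    rw [hE, map_one, map_one, mul_one, hg']
  have hT : genericSpan K n m ≤ E := by
    rw [genericSpan, Submodule.span_le, Set.insert_subset_iff]
    refine ⟨h1, ?_⟩
    rintro _ ⟨i, rfl⟩
    change _ ∈ E
    rw [hE, evalMatrix_genericMatrix, evalMatrix_genericMatrix]
    rfl
  have hEE : E * E ≤ E := by
    rw [Submodule.mul_le]
    intro a ha b hb
    rw [hE] at ha hb ⊢
    rw [map_mul, map_mul, ha, hb]
    simp only [mul_assoc]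
    rw [← mul_assoc _ (g : Matrix (Fin n) (Fin n) K), hg, one_mul]
  have : ∀ d, genericSpan K n m ^ d ≤ E := by
    intro d
    induction d with
    | zero => rw [pow_zero]; exact Submodule.one_le.mpr h1
    | succ d ih => rw [pow_succ]; exact (mul_le_mul' ih hT).trans hEE
  exact this D hF

theorem totalDegree_le_of_mem_pow {D : ℕ} {F : Matrix (Fin n) (Fin n) (Poly K n m)}
    (hF : F ∈ genericSpan K n m ^ D) (a b : Fin n) : (F a b).totalDegree ≤ D := by
  let B : ℕ → Submodule K (Matrix (Fin n) (Fin n) (Poly K n m)) := fun d =>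
    { carrier := {F | ∀ a b, F a b ∈ MvPolynomial.restrictTotalDegree _ K d}
      zero_mem' := fun a b => zero_mem _
      add_mem' := fun hF hG a b => add_mem (hF a b) (hG a b)
      smul_mem' := fun c F hF a b => Submodule.smul_mem _ c (hF a b) }
  have hB : ∀ d F, F ∈ B d ↔ ∀ a b, (F a b).totalDegree ≤ d := fun d F =>
    forall_congr' fun a => forall_congr' fun b => MvPolynomial.mem_restrictTotalDegree _ _ _
  have h1 : ∀ d, (1 : Matrix (Fin n) (Fin n) (Poly K n m)) ∈ B d := by
    intro d
    rw [hB]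
    intro a b
    rw [Matrix.one_apply]
    split_ifs <;> simp
  have hT : genericSpan K n m ≤ B 1 := by
    rw [genericSpan, Submodule.span_le, Set.insert_subset_iff]
    refine ⟨h1 1, ?_⟩
    rintro _ ⟨i, rfl⟩
    change _ ∈ B 1
    rw [hB]
    intro a b
    simp [genericMatrix]
  have : ∀ d, genericSpan K n m ^ d ≤ B d := by
    intro d
    induction d with
    | zero => rw [pow_zero]; exact Submodule.one_le.mpr (h1 0)
    | succ d ih =>
      rw [pow_succ, Submodule.mul_le]
      intro F hF G hG
      have hF := (hB _ _).mp (ih hF)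
      have hG := (hB _ _).mp (hT hG)
      rw [hB]
      intro a b
      rw [Matrix.mul_apply]
      apply MvPolynomial.totalDegree_finsetSum_le
      intro c _
      exact (MvPolynomial.totalDegree_mul _ _).trans (add_le_add (hF a c) (hG c b))
  exact (hB _ _).mp (this D hF) a b

theorem evalAt_trace (X : MatTuple K n m) (F : Matrix (Fin n) (Fin n) (Poly K n m)) :
    evalAt F.trace X = (evalMatrix X F).trace := by
  rw [evalMatrix_eq_map, evalAt]
  simp [Matrix.trace]

theorem evalAt_det (X : MatTuple K n m) (F : Matrix (Fin n) (Fin n) (Poly K n m)) :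
    evalAt F.det X = (evalMatrix X F).det := by
  rw [evalMatrix_eq_map, evalAt, RingHom.map_det]

theorem trace_mem_invariantRing {D : ℕ} {F : Matrix (Fin n) (Fin n) (Poly K n m)}
    (hF : F ∈ genericSpan K n m ^ D) : F.trace ∈ invariantRing K n m := by
  intro g X
  rw [evalAt_trace, evalAt_trace, evalMatrix_conj hF, Matrix.trace_mul_cycle,
    ← Units.val_mul, inv_mul_cancel, Units.val_one, one_mul]

theorem totalDegree_trace_le {D : ℕ} {F : Matrix (Fin n) (Fin n) (Poly K n m)}
    (hF : F ∈ genericSpan K n m ^ D) : F.trace.totalDegree ≤ D :=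
  MvPolynomial.totalDegree_finsetSum_le fun a _ => totalDegree_le_of_mem_pow hF a a

theorem one_mem_genericSpan : (1 : Matrix (Fin n) (Fin n) (Poly K n m)) ∈ genericSpan K n m :=
  Submodule.subset_span (Set.mem_insert _ _)

theorem algebraMap_sub_mem_pow {D : ℕ} {F : Matrix (Fin n) (Fin n) (Poly K n m)}
    (hF : F ∈ genericSpan K n m ^ D) (s : K) :
    algebraMap K _ s - F ∈ genericSpan K n m ^ D := by
  rw [Algebra.algebraMap_eq_smul_one]
  exact sub_mem (Submodule.smul_mem _ _ (pow_mono_of_one_mem one_mem_genericSpan (Nat.zero_le D)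
    (one_mem_pow_zero _))) hF

theorem det_mem_invariantRing {D : ℕ} {F : Matrix (Fin n) (Fin n) (Poly K n m)}
    (hF : F ∈ genericSpan K n m ^ D) : F.det ∈ invariantRing K n m := by
  intro g X
  rw [evalAt_det, evalAt_det, evalMatrix_conj hF, Matrix.det_mul, Matrix.det_mul, mul_right_comm,
    ← Matrix.det_mul, ← Units.val_mul, mul_inv_cancel, Units.val_one, Matrix.det_one, one_mul]

theorem totalDegree_det_le {D : ℕ} {F : Matrix (Fin n) (Fin n) (Poly K n m)}
    (hF : F ∈ genericSpan K n m ^ D) : F.det.totalDegree ≤ n * D := by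
  rw [Matrix.det_apply]
  apply MvPolynomial.totalDegree_finsetSum_le
  intro σ _
  rw [Units.smul_def, zsmul_eq_mul]
  have h1 : ((Equiv.Perm.sign σ : ℤ) : Poly K n m).totalDegree = 0 := by
    rw [← map_intCast (MvPolynomial.C : K →+* Poly K n m), MvPolynomial.totalDegree_C]
  have h2 : (∏ i, F (σ i) i).totalDegree ≤ n * D := by
    refine (MvPolynomial.totalDegree_finsetProd _ _).trans ?_
    refine (Finset.sum_le_card_nsmul _ _ D fun i _ => totalDegree_le_of_mem_pow hF _ _).trans ?_
    simp
  exact (MvPolynomial.totalDegree_mul _ _).trans (by omega)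

theorem evalAt_smul_of_isHomogeneous {f : Poly K n m} {d : ℕ} (hf : f.IsHomogeneous d) (t : K)
    (X : MatTuple K n m) : evalAt f (t • X) = t ^ d * evalAt f X := by
  rw [evalAt, evalAt, MvPolynomial.eval_eq, MvPolynomial.eval_eq, Finset.mul_sum]
  refine Finset.sum_congr rfl fun e he => ?_
  have hd : ∑ i ∈ e.support, e i = d := by
    have := hf (MvPolynomial.mem_support_iff.mp he)
    simpa [Finsupp.weight_apply, Finsupp.sum] using this
  rw [← hd, ← Finset.prod_pow_eq_pow_sum, mul_left_comm, ← Finset.prod_mul_distrib]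
  congr 1
  refine Finset.prod_congr rfl fun i _ => ?_
  simp [mul_pow]

theorem conj_smul (g : GL (Fin n) K) (t : K) (X : MatTuple K n m) :
    conj g (t • X) = t • conj g X := by
  funext i
  simp [conj]

theorem homogeneousComponent_mem_invariantRing [Infinite K] {f : Poly K n m}
    (hf : f ∈ invariantRing K n m) (d : ℕ) :
    MvPolynomial.homogeneousComponent d f ∈ invariantRing K n m := by
  intro g X
  have hsum : ∀ Y, evalAt f Y = ∑ i ∈ Finset.range (f.totalDegree + 1),
      evalAt (MvPolynomial.homogeneousComponent i f) Y := by
    intro Y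
    conv_lhs => rw [← MvPolynomial.sum_homogeneousComponent f]
    simp [evalAt]
  let q : Polynomial K := ∑ i ∈ Finset.range (f.totalDegree + 1), Polynomial.C
    (evalAt (MvPolynomial.homogeneousComponent i f) (conj g X) -
      evalAt (MvPolynomial.homogeneousComponent i f) X) * Polynomial.X ^ i
  have hq : q = 0 := by
    apply Polynomial.funext
    intro t
    have h := hf g (t • X)
    rw [conj_smul, hsum, hsum, ← sub_eq_zero, ← Finset.sum_sub_distrib] at h
    rw [Polynomial.eval_zero, ← h]
    simp only [q, Polynomial.eval_finsetSum, Polynomial.eval_mul, Polynomial.eval_C,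
      Polynomial.eval_pow, Polynomial.eval_X]
    refine Finset.sum_congr rfl fun i _ => ?_
    rw [evalAt_smul_of_isHomogeneous (MvPolynomial.homogeneousComponent_isHomogeneous i f),
      evalAt_smul_of_isHomogeneous (MvPolynomial.homogeneousComponent_isHomogeneous i f)]
    ring
  rcases Nat.lt_or_ge f.totalDegree d with hd | hd
  · rw [MvPolynomial.homogeneousComponent_eq_zero _ _ hd]
    simp [evalAt]
  · have h := congrArg (fun p => Polynomial.coeff p d) hq
    simp only [q, Polynomial.finsetSum_coeff, Polynomial.coeff_C_mul_X_pow,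
      Polynomial.coeff_zero] at h
    rw [Finset.sum_ite_eq, if_pos (by simp; omega)] at h
    exact sub_eq_zero.mp h

/-- Tuples not distinguished by the homogeneous invariants of degrees `1, …, D` are not
distinguished by any invariant of total degree at most `D`. -/
theorem evalAt_eq_of_totalDegree_le [Infinite K] {X Y : MatTuple K n m} {D : ℕ}
    (h : ∀ f ∈ ⋃ d ∈ Set.Icc 1 D, invariantsOfDegree K n m d, evalAt f X = evalAt f Y)
    {f : Poly K n m} (hf : f ∈ invariantRing K n m) (hD : f.totalDegree ≤ D) :
    evalAt f X = evalAt f Y := by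
  rw [← MvPolynomial.sum_homogeneousComponent f]
  have hsum : ∀ Z : MatTuple K n m, evalAt (∑ i ∈ Finset.range (f.totalDegree + 1),
      MvPolynomial.homogeneousComponent i f) Z = ∑ i ∈ Finset.range (f.totalDegree + 1),
      evalAt (MvPolynomial.homogeneousComponent i f) Z := fun Z => by simp [evalAt]
  rw [hsum, hsum]
  refine Finset.sum_congr rfl fun i hi => ?_
  rcases Nat.eq_zero_or_pos i with rfl | hi0
  · rw [MvPolynomial.homogeneousComponent_zero]
    simp [evalAt]
  · apply h
    have := Finset.mem_range.mp hi
    simp only [Set.mem_iUnion]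
    exact ⟨i, ⟨hi0, by omega⟩, homogeneousComponent_mem_invariantRing hf i,
      MvPolynomial.homogeneousComponent_isHomogeneous i f⟩

end Invariants

/-! ### Separation -/

/-- The space `Kⁿ` of column vectors, as a module over an algebra `A` acting through a
homomorphism to matrices. -/
def VecModule {K A : Type*} [Field K] [Ring A] [Algebra K A] {n : ℕ}
    (_ : A →ₐ[K] Matrix (Fin n) (Fin n) K) : Type _ :=
  Fin n → K

section VecModule

variable {K A : Type*} [Field K] [Ring A] [Algebra K A] {n : ℕ}
  (f : A →ₐ[K] Matrix (Fin n) (Fin n) K)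

instance : AddCommGroup (VecModule f) := inferInstanceAs (AddCommGroup (Fin n → K))

instance : Module K (VecModule f) := inferInstanceAs (Module K (Fin n → K))

instance : FiniteDimensional K (VecModule f) := inferInstanceAs (FiniteDimensional K (Fin n → K))

instance : Module A (VecModule f) :=
  Module.compHom (Fin n → K) ((Matrix.toLinAlgEquiv' : Matrix (Fin n) (Fin n) K ≃ₐ[K]
    ((Fin n → K) →ₗ[K] (Fin n → K))).toAlgHom.comp f).toRingHom

theorem VecModule.smul_eq_mulVec (a : A) (x : VecModule f) :
    a • x = ((f a).mulVec (x : Fin n → K) : Fin n → K) := rfl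

instance : IsScalarTower K A (VecModule f) where
  smul_assoc c a x := by
    rw [VecModule.smul_eq_mulVec, VecModule.smul_eq_mulVec, map_smul]
    exact Matrix.smul_mulVec c (f a) x

theorem VecModule.finrank_eq : finrank K (VecModule f) = n :=
  (Module.finrank_fintype_fun_eq_card K).trans (Fintype.card_fin n)

theorem VecModule.charpoly_lsmul (a : A) :
    (Algebra.lsmul K K (VecModule f) a).charpoly = (f a).charpoly :=
  Matrix.charpoly_toLin' (f a)

theorem VecModule.trace_lsmul (a : A) :
    LinearMap.trace K (VecModule f) (Algebra.lsmul K K (VecModule f) a) = (f a).trace :=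
  Matrix.trace_toLin'_eq (f a)

variable {f}

theorem exists_conj_of_linearEquiv {f' : A →ₐ[K] Matrix (Fin n) (Fin n) K}
    (φ : VecModule f ≃ₗ[A] VecModule f') :
    ∃ g : GL (Fin n) K, ∀ a, (g : Matrix (Fin n) (Fin n) K) * f a *
      ((g⁻¹ : GL (Fin n) K) : Matrix (Fin n) (Fin n) K) = f' a := by
  let φ' : (Fin n → K) ≃ₗ[K] (Fin n → K) := φ.restrictScalars K
  let g : GL (Fin n) K := ⟨LinearMap.toMatrix' φ', LinearMap.toMatrix' φ'.symm,
    by rw [← LinearMap.toMatrix'_mul]; simp [Module.End.mul_eq_comp],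
    by rw [← LinearMap.toMatrix'_mul]; simp [Module.End.mul_eq_comp]⟩
  refine ⟨g, fun a => ?_⟩
  have h : (g : Matrix (Fin n) (Fin n) K) * f a = f' a * g := by
    apply Matrix.toLin'.injective
    rw [Matrix.toLin'_mul, Matrix.toLin'_mul]
    simp only [g, Matrix.toLin'_toMatrix']
    exact LinearMap.ext fun x => φ.map_smul a x
  rw [h, mul_assoc, ← Units.val_mul, mul_inv_cancel, Units.val_one, mul_one]

end VecModule

theorem exists_mem_pow_of_mem_adjoin {K A : Type*} [Field K] [Ring A] [Algebra K A]
    {S : Submodule K A} (h1 : (1 : A) ∈ S) {s : Set A} (hs : s ⊆ S) {a : A}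
    (ha : a ∈ Algebra.adjoin K s) : ∃ i, a ∈ S ^ i := by
  induction ha using Algebra.adjoin_induction with
  | mem x hx => exact ⟨1, by rw [pow_one]; exact hs hx⟩
  | algebraMap r =>
    refine ⟨0, ?_⟩
    rw [Algebra.algebraMap_eq_smul_one]
    exact Submodule.smul_mem _ _ (one_mem_pow_zero S)
  | add x y _ _ hx hy =>
    obtain ⟨i, hi⟩ := hx
    obtain ⟨k, hk⟩ := hy
    exact ⟨max i k, add_mem (pow_mono_of_one_mem h1 (le_max_left i k) hi)
      (pow_mono_of_one_mem h1 (le_max_right i k) hk)⟩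
  | mul x y _ _ hx hy =>
    obtain ⟨i, hi⟩ := hx
    obtain ⟨k, hk⟩ := hy
    exact ⟨i + k, by rw [pow_add]; exact Submodule.mul_mem_mul hi hk⟩

section Separation

variable {K : Type*} [Field K] {n m : ℕ}

/-- Two tuples generating semiprime algebras are conjugate as soon as the words of length `D` in
the generic matrices have equal characteristic polynomials on them, or, in characteristic zero,
equal traces. The pairs generate a semisimple algebra, whose two natural modules are compared. -/
theorem exists_conj_eq_of_charpoly_eq_or_trace_eq [IsAlgClosed K] {X Y : MatTuple K n m} {D : ℕ}
    (hXs : ∀ j ∈ Algebra.adjoin K (Set.range X),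
      (∀ a ∈ Algebra.adjoin K (Set.range X), j * a * j = 0) → j = 0)
    (hYs : ∀ j ∈ Algebra.adjoin K (Set.range Y),
      (∀ a ∈ Algebra.adjoin K (Set.range Y), j * a * j = 0) → j = 0)
    (hD : 2 * (((n + n : ℕ) : ℝ) * Real.logb 2 (n + n : ℕ)) + (n + n : ℕ) ≤ D)
    (h : (∀ F ∈ genericSpan K n m ^ D, (evalMatrix X F).charpoly = (evalMatrix Y F).charpoly) ∨
      (CharZero K ∧ ∀ F ∈ genericSpan K n m ^ D,
        (evalMatrix X F).trace = (evalMatrix Y F).trace)) :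
    ∃ g : GL (Fin n) K, conj g X = Y := by
  let R := Matrix (Fin n) (Fin n) K
  let A : Subalgebra K (R × R) := Algebra.adjoin K (Set.range fun i => (X i, Y i))
  let f₁ : A →ₐ[K] R := (AlgHom.fst K R R).comp A.val
  let f₂ : A →ₐ[K] R := (AlgHom.snd K R R).comp A.val
  have hA₁ : A.map (AlgHom.fst K R R) = Algebra.adjoin K (Set.range X) := by
    simp only [A]
    rw [AlgHom.map_adjoin, ← Set.range_comp]; rfl
  have hA₂ : A.map (AlgHom.snd K R R) = Algebra.adjoin K (Set.range Y) := by
    simp only [A]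
    rw [AlgHom.map_adjoin, ← Set.range_comp]; rfl
  have hsp : ∀ j : A, (∀ a, j * a * j = 0) → j = 0 := by
    intro j hj
    apply Subtype.ext
    apply Prod.ext
    · apply hXs
      · rw [← hA₁]; exact ⟨j, j.2, rfl⟩
      · intro a ha
        rw [← hA₁] at ha
        obtain ⟨b, hb, rfl⟩ := ha
        exact congrArg (fun z : A => (z : R × R).1) (hj ⟨b, hb⟩)
    · apply hYs
      · rw [← hA₂]; exact ⟨j, j.2, rfl⟩
      · intro a ha
        rw [← hA₂] at ha
        obtain ⟨b, hb, rfl⟩ := ha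
        exact congrArg (fun z : A => (z : R × R).2) (hj ⟨b, hb⟩)
  have : IsArtinianRing A := IsArtinianRing.of_finite K A
  have : IsSemisimpleRing A := isSemisimpleRing_of_semiprime hsp
  let Θ : Matrix (Fin n) (Fin n) (Poly K n m) →ₐ[K] R × R := (evalMatrix X).prod (evalMatrix Y)
  have hΘ : ∀ F, Θ F = (evalMatrix X F, evalMatrix Y F) := fun F => rfl
  let S' : Submodule K (R × R) := (genericSpan K n m).map Θ.toLinearMap
  let S : Submodule K A := S'.comap A.val.toLinearMap
  have h1 : (1 : A) ∈ S := ⟨1, one_mem_genericSpan, map_one Θ⟩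
  have hgen : ∀ i, (X i, Y i) ∈ S' := fun i =>
    ⟨genericMatrix K n m i, Submodule.subset_span (Set.mem_insert_of_mem _ ⟨i, rfl⟩), by
      change Θ _ = _
      rw [hΘ, evalMatrix_genericMatrix, evalMatrix_genericMatrix]⟩
  have hS : ∀ a : A, ∃ i, a ∈ S ^ i := by
    intro a
    have hAtop : Algebra.adjoin K (Set.range fun i =>
        (⟨(X i, Y i), Algebra.subset_adjoin ⟨i, rfl⟩⟩ : A)) = ⊤ := by
      apply Subalgebra.map_injective (f := A.val) Subtype.val_injective
      rw [AlgHom.map_adjoin, ← Set.range_comp, Algebra.map_top, Subalgebra.range_val]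
      rfl
    apply exists_mem_pow_of_mem_adjoin h1 (s := Set.range fun i =>
        (⟨(X i, Y i), Algebra.subset_adjoin ⟨i, rfl⟩⟩ : A))
    · rintro _ ⟨i, rfl⟩
      exact hgen i
    · rw [hAtop]; trivial
  have hword : ∀ a ∈ S ^ D, ∃ F ∈ genericSpan K n m ^ D, evalMatrix X F = f₁ a ∧
      evalMatrix Y F = f₂ a := by
    intro a ha
    have h2 : (S ^ D).map A.val.toLinearMap ≤ S' ^ D := by
      rw [Submodule.map_pow]
      exact pow_le_pow_left' (Submodule.map_comap_le _ _) D
    have h3 : (a : R × R) ∈ S' ^ D := h2 ⟨a, ha, rfl⟩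
    rw [← Submodule.map_pow] at h3
    obtain ⟨F, hF, hFa⟩ := h3
    exact ⟨F, hF, congrArg Prod.fst hFa, congrArg Prod.snd hFa⟩
  have hφ : Nonempty (VecModule f₁ ≃ₗ[A] VecModule f₂) := by
    refine nonempty_linearEquiv_of_charpoly_eq_or_trace_eq (K := K) h1 hS (n + n)
      (VecModule f₁) (VecModule f₂) ?_ hD ?_
    · rw [VecModule.finrank_eq, VecModule.finrank_eq]
    · rcases h with h | ⟨h0, h⟩
      · left
        intro a ha
        obtain ⟨F, hF, e1, e2⟩ := hword a ha
        rw [VecModule.charpoly_lsmul, VecModule.charpoly_lsmul, ← e1, ← e2]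
        exact h F hF
      · right
        refine ⟨h0, fun a ha => ?_⟩
        obtain ⟨F, hF, e1, e2⟩ := hword a ha
        rw [VecModule.trace_lsmul, VecModule.trace_lsmul, ← e1, ← e2]
        exact h F hF
  obtain ⟨φ⟩ := hφ
  obtain ⟨g, hg⟩ := exists_conj_of_linearEquiv φ
  exact ⟨g, funext fun i => hg ⟨(X i, Y i), Algebra.subset_adjoin ⟨i, rfl⟩⟩⟩

/-- The invariants of degree at most `E` are separating when `E` bounds the degrees of the
coefficients of the characteristic polynomials of words of length `D` or, in characteristic zero,
of their traces. -/
theorem mem_separatingDegrees [IsAlgClosed K] {D E : ℕ} (hE : 1 ≤ E)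
    (hD : 2 * (((n + n : ℕ) : ℝ) * Real.logb 2 (n + n : ℕ)) + (n + n : ℕ) ≤ D)
    (h : n * D ≤ E ∨ CharZero K ∧ D ≤ E) : E ∈ separatingDegrees K n m := by
  refine ⟨hE, ?_, fun X Y hXY => ?_⟩
  · intro f hf
    simp only [Set.mem_iUnion] at hf
    obtain ⟨d, -, hf⟩ := hf
    exact hf.1
  by_contra! hcon
  apply hXY
  obtain ⟨X', hX', hXs⟩ := exists_mem_zariskiClosure_semiprime X
  obtain ⟨Y', hY', hYs⟩ := exists_mem_zariskiClosure_semiprime Y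
  have hagree : ∀ f ∈ invariantRing K n m, f.totalDegree ≤ E → evalAt f X' = evalAt f Y' := by
    intro f hf hfE
    rw [evalAt_eq_of_mem_zariskiClosure hf hX', evalAt_eq_of_mem_zariskiClosure hf hY']
    exact evalAt_eq_of_totalDegree_le hcon hf hfE
  obtain ⟨g, hg⟩ := exists_conj_eq_of_charpoly_eq_or_trace_eq hXs hYs hD (by
    rcases h with h | ⟨h0, h⟩
    · left
      intro F hF
      apply Polynomial.funext
      intro t
      have ht := algebraMap_sub_mem_pow hF t
      have := hagree _ (det_mem_invariantRing ht) ((totalDegree_det_le ht).trans h)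
      rw [evalAt_det, evalAt_det, map_sub, map_sub, AlgHom.commutes, AlgHom.commutes] at this
      rw [Matrix.eval_charpoly, Matrix.eval_charpoly]
      exact this
    · right
      refine ⟨h0, fun F hF => ?_⟩
      have := hagree _ (trace_mem_invariantRing hF) ((totalDegree_trace_le hF).trans h)
      rwa [evalAt_trace, evalAt_trace] at this)
  exact ⟨Y', hg ▸ conj_mem_zariskiClosure_orbit hX' g, hY'⟩

end Separation

end MatInv

theorem theorem1p9 (K : Type*) [Field K] [IsAlgClosed K] (n m : ℕ) (hn : 1 ≤ n) :
    (MatInv.separatingDegrees K n m).Nonempty ∧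
    (MatInv.betaSep K n m : ℝ) ≤
      4 * (n : ℝ) ^ 2 * Real.logb 2 (n : ℝ) + 12 * (n : ℝ) ^ 2 - 4 * (n : ℝ) ∧
    (CharZero K →
      (MatInv.betaSep K n m : ℝ) ≤ 4 * (n : ℝ) * Real.logb 2 (n : ℝ) + 12 * (n : ℝ) - 4) := by
  have hn1 : (1 : ℝ) ≤ n := by exact_mod_cast hn
  have hlog : 0 ≤ Real.logb 2 (n : ℝ) := Real.logb_nonneg (by norm_num) hn1
  have hnl : 0 ≤ (n : ℝ) * Real.logb 2 (n : ℝ) := by positivity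
  -- `2 N log₂ N + N` for `N = 2 n`
  set D := ⌈4 * ((n : ℝ) * Real.logb 2 (n : ℝ)) + 6 * n⌉₊ with hDdef
  have hDlo : 4 * ((n : ℝ) * Real.logb 2 (n : ℝ)) + 6 * n ≤ D := Nat.le_ceil _
  have hDhi : (D : ℝ) < 4 * ((n : ℝ) * Real.logb 2 (n : ℝ)) + 6 * n + 1 :=
    Nat.ceil_lt_add_one (by positivity)
  have hD : 2 * (((n + n : ℕ) : ℝ) * Real.logb 2 (n + n : ℕ)) + (n + n : ℕ) ≤ D := by
    have h2 : ((n + n : ℕ) : ℝ) = 2 * n := by push_cast; ring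
    have h3 : Real.logb 2 (2 * (n : ℝ)) = 1 + Real.logb 2 n := by
      rw [Real.logb_mul (by norm_num) (by linarith), Real.logb_self_eq_one (by norm_num)]
    rw [h2, h3]
    linarith
  have hD1 : 1 ≤ D := by
    have : (1 : ℝ) ≤ D := by linarith
    exact_mod_cast this
  have hmem : n * D ∈ MatInv.separatingDegrees K n m :=
    MatInv.mem_separatingDegrees (Nat.mul_pos hn hD1) hD (Or.inl le_rfl)
  refine ⟨⟨_, hmem⟩, ?_, fun h0 => ?_⟩
  · have h1 : (MatInv.betaSep K n m : ℝ) ≤ (n * D : ℕ) := by exact_mod_cast Nat.sInf_le hmem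
    push_cast at h1
    nlinarith
  · have hmem0 : D ∈ MatInv.separatingDegrees K n m :=
      MatInv.mem_separatingDegrees hD1 hD (Or.inr ⟨h0, le_rfl⟩)
    have h1 : (MatInv.betaSep K n m : ℝ) ≤ D := by exact_mod_cast Nat.sInf_le hmem0
    linarith
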